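/- **Setting.** Let $A$ be a (not necessarily unital) $C^*$-algebra with multiplier algebra $M(A)$ and $S$ an abelian semigroup with identity $0$. Let $\alpha$ be an action of $S$ on $A$ by extendible endomorphisms ($\alpha_0=\mathrm{id}$, $\alpha_{s+t}=\alpha_s\alpha_t$, and each $\alpha_s$ extends uniquely to an endomorphism $\overline{\alpha_s}$ of $M(A)$ such that $\overline{\alpha_s}(1)$ is the strict limit of $\alpha_s(u_\lambda)$ for some approximate unit $(u_\lambda)$ of $A$). Let $L$ be an action of $S$ by continuous positive linear maps $L_s:A\to A$ ($L_0=\mathrm{id}$, $L_{s+t}=L_sL_t$) with continuous linear extensions $\overline{L_s}:M(A)\to M(A)$ satisfying $L_s(\alpha_s(a)u)=a\overline{L_s}(u)$ for $a\in A$, $u\in M(A)$. Approximate units are two-sided and bounded. **The product system.** For $s\in S$ let $M_s$ be the Hausdorff completion of $A_s=A\,\overline{\alpha_s}(1)$ for the pre-inner product $\langle x,y\rangle_s=L_s(x^*y)$; it is a Hilbert $A$-bimodule with $x\cdot a=x\alpha_s(a)$ and $a\cdot x=ax$ for $x\in A_s$. Let $X=\bigsqcup_{s}X_s$, $X_s=\{s\}\times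 M_s$, with the multiplication extending by continuity $(s,x)(t,y)=(s+t,x\alpha_s(y))$ for $x\in A_s$, $y\in A_t$; $X_0$ is identified with $A$. A Toeplitz representation of $X$ in a $C^*$-algebra $B$ is a map $\psi:X\to B$, with restrictions $\psi_s=\psi|_{X_s}$, such that $\psi(x)\psi(y)=\psi(xy)$, each $\psi_s$ is linear, $\psi_0:A\to B$ is a $*$-homomorphism, and $\psi_s(x\cdot a)=\psi_s(x)\psi_0(a)$, $\psi_s(x)^*\psi_s(y)=\psi_0(\langle x,y\rangle_s)$, $\psi_s(a\cdot x)=\psi_0(a)\psi_s(x)$ for $x,y\in X_s$, $a\in A$. A Toeplitz algebra of $X$ is a $C^*$-algebra $\mathcal T_X$ with a Toeplitz representation $i_X:X\to\mathcal T_X$ whose range generates $\mathcal T_X$ and through which every Toeplitz representation $\psi$ factors: $\psi=\psi_*\circ i_X$ for a $*$-homomorphism $\psi_*$ on $\mathcal T_X$. **Toeplitz crossed products.** A Toeplitz covariant representation of $(A,S,\alpha,L)$ on a Hilbert space $H$ is a non-degenerate representation $\pi:A\to B(H)$ together with $V:S\to B(H)$ satisfying $V_0=1$, $V_{s+t}=V_sV_t$,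 $V_s\pi(a)=\pi(\alpha_s(a))V_s$ and $V_s^*\pi(a)V_s=\pi(L_s(a))$ for all $a\in A$, $s,t\in S$. A Toeplitz crossed product for $(A,S,\alpha,L)$ is a triple $(B,i_A,i_S)$ of a $C^*$-algebra $B$, a non-degenerate homomorphism $i_A:A\to B$ and a map $i_S:S\to M(B)$ with $i_S(0)=1$ and $i_S(s+t)=i_S(s)i_S(t)$ such that (i) for every non-degenerate representation $\sigma$ of $B$, with extension $\overline\sigma$ to $M(B)$, $(\sigma\circ i_A,\overline\sigma\circ i_S)$ is a Toeplitz covariant representation; (ii) for every Toeplitz covariant representation $(\pi,V)$ there is a (non-degenerate) representation $\pi\times V$ of $B$ with $(\pi\times V)\circ i_A=\pi$ and $\overline{\pi\times V}\circ i_S=V$; (iii) $B$ is generated as a $C^*$-algebra by $\{i_A(a)i_S(s): a\in A,\ s\in S\}$. **Proposition.** A Toeplitz algebra of $X$ exists, and for every Toeplitz algebra $(\mathcal T_X,i_X)$ of $X$: (1) If $(u_\lambda)$ is an approximate unit for $A$ and $s\in S$, then $(i_X(s,\alpha_s(u_\lambda)))_\lambda$ converges strictly in $M(\mathcal T_X)$.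 (2) Let $i_A(a)=i_X(0,a)$ for $a\in A$ and $i_S(s)=\lim_\lambda i_X(s,\alpha_s(u_\lambda))$ for $s\in S$; the limit does not depend on the approximate unit. Then $(\mathcal T_X,i_A,i_S)$ is a Toeplitz crossed product for $(A,S,\alpha,L)$, and $i_A$ is injective. -/

import Mathlib

open Filter Topology
open scoped MultiplierAlgebra

universe u v

noncomputable section

/-! ### Approximate units, strict convergence, extendible endomorphisms -/

section General

variable {A : Type*} [NonUnitalCStarAlgebra A]

/-- A bounded (two-sided) approximate unit, given as a filter on the algebra; a net `(u_λ)` gives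
the filter of its tails.  Increasing nets of positive contractions are a special case. -/
structure IsBoundedApproximateUnit (l : Filter A) : Prop where
  isApproximateUnit : l.IsApproximateUnit
  bounded : ∃ C : ℝ, ∀ᶠ u in l, ‖u‖ ≤ C

/-- Strict convergence in the multiplier algebra: `f i * b → m * b` and `b * f i → b * m` in norm
for every `b`.  (For a double centralizer `m`, `m.fst b` is `m * b` and `m.snd b` is `b * m`.) -/
def StrictTendsto {ι : Type*} (f : ι → 𝓜(ℂ, A)) (l : Filter ι) (m : 𝓜(ℂ, A)) : Prop :=
  ∀ b : A, Tendsto (fun i => (f i).fst b) l (𝓝 (m.fst b)) ∧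
    Tendsto (fun i => (f i).snd b) l (𝓝 (m.snd b))

/-- `Φ` is an extension of `φ` to the multiplier algebra with `Φ 1 = lim φ (u_λ)` strictly. -/
structure IsMultiplierExtension (φ : A →⋆ₙₐ[ℂ] A) (Φ : 𝓜(ℂ, A) →⋆ₙₐ[ℂ] 𝓜(ℂ, A)) : Prop where
  map_coe : ∀ a : A, Φ (a : 𝓜(ℂ, A)) = (φ a : 𝓜(ℂ, A))
  strict_one : ∃ l : Filter A, IsBoundedApproximateUnit l ∧
    StrictTendsto (fun u => (φ u : 𝓜(ℂ, A))) l (Φ 1)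

/-- The endomorphism `φ` is extendible. -/
def IsExtendible (φ : A →⋆ₙₐ[ℂ] A) : Prop :=
  ∃! Φ : 𝓜(ℂ, A) →⋆ₙₐ[ℂ] 𝓜(ℂ, A), IsMultiplierExtension φ Φ

lemma eq_of_forall_mul_right_eq {a b : A} (h : ∀ y, a * y = b * y) : a = b := by
  rw [← sub_eq_zero, ← CStarRing.mul_star_self_eq_zero_iff, sub_mul, sub_eq_zero]
  exact h _

lemma multiplier_snd_mul (m : 𝓜(ℂ, A)) (b a : A) : m.snd (b * a) = b * m.snd a :=
  eq_of_forall_mul_right_eq fun y => by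
    rw [m.central, mul_assoc, mul_assoc, m.central]

lemma IsMultiplierExtension.snd_one_apply {φ : A →⋆ₙₐ[ℂ] A} {Φ : 𝓜(ℂ, A) →⋆ₙₐ[ℂ] 𝓜(ℂ, A)}
    (h : IsMultiplierExtension φ Φ) (a : A) : (Φ 1).snd (φ a) = φ a :=
  eq_of_forall_mul_right_eq fun y => by
    have h1 : Φ (a : 𝓜(ℂ, A)) * Φ 1 = Φ (a : 𝓜(ℂ, A)) := by rw [← map_mul, mul_one]
    rw [h.map_coe] at h1
    have h2 := congrArg (fun m : 𝓜(ℂ, A) => m.fst y) h1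
    rw [(Φ 1).central]
    simpa using h2

end General

/-- A dynamical system `(A, S, α, L)`: an action `α` of the abelian semigroup `S` (with identity
`0`) by extendible endomorphisms of the `C*`-algebra `A`, and an action `L` of `S` by continuous
positive linear maps admitting continuous linear extensions to the multiplier algebra which satisfy
the transfer operator identity `L_s (α_s(a) u) = a (extension of L_s)(u)`. -/
structure TransferSystem (A : Type u) [NonUnitalCStarAlgebra A] [PartialOrder A]
    [StarOrderedRing A] (S : Type v) [AddCommMonoid S] where
  α : S → A →⋆ₙₐ[ℂ] A
  α_zero : ∀ a, α 0 a = a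
  α_add : ∀ s t a, α (s + t) a = α s (α t a)
  extendible : ∀ s, IsExtendible (α s)
  L : S → A →L[ℂ] A
  L_nonneg : ∀ s a, 0 ≤ a → 0 ≤ L s a
  L_zero : ∀ a, L 0 a = a
  L_add : ∀ s t a, L (s + t) a = L s (L t a)
  transfer : ∀ s, ∃ Lbar : 𝓜(ℂ, A) →L[ℂ] 𝓜(ℂ, A),
    (∀ a : A, Lbar (a : 𝓜(ℂ, A)) = (L s a : 𝓜(ℂ, A))) ∧
    ∀ (a : A) (u : 𝓜(ℂ, A)), L s (u.snd (α s a)) = (Lbar u).snd a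

namespace TransferSystem

variable {A : Type u} [NonUnitalCStarAlgebra A] [PartialOrder A] [StarOrderedRing A]
  {S : Type v} [AddCommMonoid S] (D : TransferSystem A S)

/-- The extension of `α_s` to the multiplier algebra. -/
def αBar (s : S) : 𝓜(ℂ, A) →⋆ₙₐ[ℂ] 𝓜(ℂ, A) := (D.extendible s).choose

lemma isMultiplierExtension_αBar (s : S) : IsMultiplierExtension (D.α s) (D.αBar s) :=
  (D.extendible s).choose_spec.1

lemma continuous_α (s : S) : Continuous (D.α s) := map_continuous _

/-! ### Elementary identities for transfer operators -/

lemma L_alpha_mul (s : S) (a b : A) : D.L s (D.α s a * b) = a * D.L s b := by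
  obtain ⟨Lbar, h1, h2⟩ := D.transfer s
  have := h2 a (b : 𝓜(ℂ, A))
  rw [h1] at this
  simpa using this

lemma L_star (s : S) (a : A) : D.L s (star a) = star (D.L s a) := by
  let P : A →ₚ[ℂ] A := PositiveLinearMap.mk₀ (D.L s : A →ₗ[ℂ] A) (D.L_nonneg s)
  exact map_star P a

lemma L_mul_alpha (s : S) (a b : A) : D.L s (b * D.α s a) = D.L s b * a := by
  have h := D.L_alpha_mul s (star a) (star b)
  rw [map_star, ← star_mul, L_star, L_star, ← star_mul] at h
  exact star_injective h

/-! ### The pre-Hilbert modules `A_s = A * αBar_s(1)` -/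

/-- The subspace `A * αBar_s(1)` of `A`. -/
def cornerIdeal (s : S) : Submodule ℂ A :=
  LinearMap.range ((D.αBar s 1).snd : A →ₗ[ℂ] A)

lemma mem_cornerIdeal {s : S} {x : A} : x ∈ D.cornerIdeal s ↔ (D.αBar s 1).snd x = x := by
  constructor
  · rintro ⟨y, rfl⟩
    have h : D.αBar s 1 * D.αBar s 1 = D.αBar s 1 := by rw [← map_mul, mul_one]
    exact congrArg (fun m : 𝓜(ℂ, A) => m.snd y) h
  · intro h
    exact ⟨x, h⟩

lemma mul_alpha_mem (s : S) (x a : A) : x * D.α s a ∈ D.cornerIdeal s := by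
  rw [mem_cornerIdeal, multiplier_snd_mul, (D.isMultiplierExtension_αBar s).snd_one_apply]

lemma alpha_mem (s : S) (a : A) : D.α s a ∈ D.cornerIdeal s :=
  D.mem_cornerIdeal.2 ((D.isMultiplierExtension_αBar s).snd_one_apply a)

lemma left_mul_mem {s : S} (a : A) {x : A} (hx : x ∈ D.cornerIdeal s) :
    a * x ∈ D.cornerIdeal s := by
  rw [mem_cornerIdeal] at hx ⊢
  rw [multiplier_snd_mul, hx]

lemma mul_alpha_mem_add (s t : S) (x : A) {y : A} (hy : y ∈ D.cornerIdeal t) :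
    x * D.α s y ∈ D.cornerIdeal (s + t) := by
  refine D.left_mul_mem x ?_
  obtain ⟨l, hl, hs⟩ := (D.isMultiplierExtension_αBar t).strict_one
  have := hl.isApproximateUnit.neBot
  have hlim := (hs y).2
  rw [D.mem_cornerIdeal.1 hy] at hlim
  have hclosed : IsClosed {z : A | D.α s z ∈ D.cornerIdeal (s + t)} := by
    simp only [mem_cornerIdeal]
    exact isClosed_eq ((D.αBar (s + t) 1).snd.continuous.comp (D.continuous_α s))
      (D.continuous_α s)
  refine hclosed.mem_of_tendsto hlim (Eventually.of_forall fun u => ?_)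
  have h : ((D.α t u : A) : 𝓜(ℂ, A)).snd y = y * D.α t u := rfl
  simp only [h, Set.mem_ofPred_eq, map_mul, ← D.α_add]
  exact D.mul_alpha_mem _ _ _

/-- The space `A_s = A * αBar_s(1)`, a type synonym which will carry the seminorm of the pre-inner
product `⟨x, y⟩_s = L_s (x^* y)` instead of the norm of `A`. -/
def PreFiber (s : S) : Type u := D.cornerIdeal s

variable {D}

instance (s : S) : AddCommGroup (D.PreFiber s) := inferInstanceAs (AddCommGroup (D.cornerIdeal s))

instance (s : S) : Module ℂ (D.PreFiber s) := inferInstanceAs (Module ℂ (D.cornerIdeal s))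

variable (D) in
/-- The inclusion of `A_s` into `A`. -/
def incl (s : S) : D.PreFiber s →ₗ[ℂ] A := (D.cornerIdeal s).subtype

variable (D) in
lemma incl_mem (s : S) (x : D.PreFiber s) : D.incl s x ∈ D.cornerIdeal s := Subtype.prop x

variable (D) in
/-- The pre-inner product `⟨x, y⟩_s = L_s (x^* y)`. -/
def preInner (s : S) (x y : D.PreFiber s) : A := D.L s (star (D.incl s x) * D.incl s y)

/-- The seminorm `‖x‖_s = ‖⟨x, x⟩_s‖^(1/2)`. -/
instance (s : S) : Norm (D.PreFiber s) := ⟨fun x => √‖D.preInner s x x‖⟩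

lemma preFiber_norm_sq {s : S} (x : D.PreFiber s) : ‖x‖ ^ 2 = ‖D.preInner s x x‖ :=
  Real.sq_sqrt (norm_nonneg _)

lemma preInner_self_nonneg (s : S) (x : D.PreFiber s) : 0 ≤ D.preInner s x x :=
  D.L_nonneg _ _ (star_mul_self_nonneg _)

/-- Cauchy-Schwarz inequality for the pre-inner product. -/
lemma norm_preInner_le (s : S) (x y : D.PreFiber s) : ‖D.preInner s x y‖ ≤ ‖x‖ * ‖y‖ := by
  set z := D.preInner s x y with hz
  have key : ∀ N : ℝ, 0 < N → ‖D.preInner s x x‖ ≤ N → ‖z‖ ^ 2 ≤ N * ‖y‖ ^ 2 := by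
    intro N hN hxN
    set p := D.incl s x
    set q := D.incl s y
    have h0 : 0 ≤ D.L s (star (p * D.α s z - (N : ℂ) • q) * (p * D.α s z - (N : ℂ) • q)) :=
      D.L_nonneg _ _ (star_mul_self_nonneg _)
    have hx : D.L s (star p * p) = D.preInner s x x := rfl
    have hy : D.L s (star q * q) = D.preInner s y y := rfl
    have hxy : D.L s (star p * q) = z := rfl
    have hyx : D.L s (star q * p) = star z := by rw [← hxy, ← L_star, star_mul, star_star]
    have h1 : D.L s (star (p * D.α s z - (N : ℂ) • q) * (p * D.α s z - (N : ℂ) • q)) =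
        star z * D.preInner s x x * z - N • (star z * z) - N • (star z * z)
          + N • N • D.preInner s y y := by
      have e1 : star (p * D.α s z - (N : ℂ) • q) * (p * D.α s z - (N : ℂ) • q) =
          D.α s (star z) * (star p * p * D.α s z) - (N : ℂ) • (D.α s (star z) * (star p * q))
          - (N : ℂ) • (star q * p * D.α s z) + (N : ℂ) • (N : ℂ) • (star q * q) := by
        simp only [star_sub, star_mul, star_smul, map_star, sub_mul, mul_sub, smul_mul_assoc,
          mul_smul_comm, smul_sub, mul_assoc, RCLike.star_def, Complex.conj_ofReal]
        abel
      rw [e1]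
      simp only [map_add, map_sub, map_smul, L_alpha_mul, L_mul_alpha, hx, hy, hxy, hyx]
      simp only [mul_assoc, Complex.coe_smul]
    rw [h1] at h0
    have h2 : star z * D.preInner s x x * z ≤ N • (star z * z) :=
      (CStarAlgebra.star_left_conjugate_le_norm_smul
        (hb := .of_nonneg (preInner_self_nonneg s x))).trans
        (smul_le_smul_of_nonneg_right hxN (star_mul_self_nonneg z))
    have h3 : N • (star z * z) ≤ N • N • D.preInner s y y := by
      have h4 : 0 ≤ N • (star z * z) - N • (star z * z) - N • (star z * z)
          + N • N • D.preInner s y y := h0.trans (by gcongr)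
      rw [sub_self, zero_sub, neg_add_eq_sub] at h4
      exact sub_nonneg.1 h4
    have h5 : star z * z ≤ N • D.preInner s y y := (smul_le_smul_iff_of_pos_left hN).1 h3
    have h6 := CStarAlgebra.norm_le_norm_of_nonneg_of_le (star_mul_self_nonneg z) h5
    rwa [CStarRing.norm_star_mul_self, norm_smul, Real.norm_of_nonneg hN.le, ← preFiber_norm_sq,
      ← sq] at h6
  have key2 : ‖z‖ ^ 2 ≤ ‖x‖ ^ 2 * ‖y‖ ^ 2 := by
    rw [preFiber_norm_sq x]
    have hlim : Tendsto (fun ε : ℝ => (‖D.preInner s x x‖ + ε) * ‖y‖ ^ 2) (𝓝[>] 0)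
        (𝓝 ((‖D.preInner s x x‖ + 0) * ‖y‖ ^ 2)) :=
      (Continuous.tendsto (by fun_prop) 0).mono_left nhdsWithin_le_nhds
    rw [add_zero] at hlim
    refine ge_of_tendsto hlim ?_
    filter_upwards [self_mem_nhdsWithin] with ε hε
    have hε' : (0 : ℝ) < ε := hε
    exact key _ (by positivity) (by linarith)
  rw [← mul_pow] at key2
  exact le_of_sq_le_sq key2 (mul_nonneg (Real.sqrt_nonneg _) (Real.sqrt_nonneg _))

lemma preFiber_core (s : S) : SeminormedSpace.Core ℂ (D.PreFiber s) where
  norm_nonneg _ := Real.sqrt_nonneg _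
  norm_smul c x := by
    have h : D.preInner s (c • x) (c • x) = (star c * c) • D.preInner s x x := by
      simp only [preInner, map_smul, star_smul, smul_mul_assoc, mul_smul_comm, smul_smul,
        mul_comm]
    refine (sq_eq_sq₀ (Real.sqrt_nonneg _)
      (mul_nonneg (norm_nonneg _) (Real.sqrt_nonneg _))).1 ?_
    change ‖c • x‖ ^ 2 = (‖c‖ * ‖x‖) ^ 2
    rw [mul_pow, preFiber_norm_sq, preFiber_norm_sq, h, norm_smul, norm_mul, norm_star, sq]
  norm_triangle x y := by
    have hx : 0 ≤ ‖x‖ := Real.sqrt_nonneg _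
    have hy : 0 ≤ ‖y‖ := Real.sqrt_nonneg _
    refine le_of_sq_le_sq ?_ (add_nonneg hx hy)
    have h : D.preInner s (x + y) (x + y) =
        D.preInner s x x + D.preInner s x y + D.preInner s y x + D.preInner s y y := by
      simp only [preInner, map_add, star_add, add_mul, mul_add]
      abel
    rw [preFiber_norm_sq, h]
    calc _ ≤ ‖D.preInner s x x‖ + ‖D.preInner s x y‖ + ‖D.preInner s y x‖
          + ‖D.preInner s y y‖ := norm_add₄_le
      _ ≤ ‖x‖ ^ 2 + ‖x‖ * ‖y‖ + ‖y‖ * ‖x‖ + ‖y‖ ^ 2 := by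
        rw [preFiber_norm_sq, preFiber_norm_sq]
        gcongr <;> exact norm_preInner_le s _ _
      _ = _ := by ring

instance (s : S) : SeminormedAddCommGroup (D.PreFiber s) :=
  SeminormedAddCommGroup.ofCore (preFiber_core s)

instance (s : S) : NormedSpace ℂ (D.PreFiber s) where
  norm_smul_le c x := ((preFiber_core s).norm_smul c x).le

/-! ### The Hilbert bimodules `M_s` -/

variable (D) in
/-- `M_s`: the Hausdorff completion of `A_s` (the quotient by the null vectors, completed). -/
abbrev Fiber (s : S) : Type u := UniformSpace.Completion (D.PreFiber s)

/-- Extension by continuity of a bounded linear map from a seminormed space to its Hausdorff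
completion. -/
def extendCLM {E G : Type*} [SeminormedAddCommGroup E] [NormedSpace ℂ E]
    [SeminormedAddCommGroup G] [NormedSpace ℂ G] [T0Space G] [CompleteSpace G] {σ : ℂ →+* ℂ} (f : E →SL[σ] G) :
    UniformSpace.Completion E →SL[σ] G :=
  f.extend (UniformSpace.Completion.toComplL : E →L[ℂ] UniformSpace.Completion E)

lemma extendCLM_coe {E G : Type*} [SeminormedAddCommGroup E] [NormedSpace ℂ E]
    [SeminormedAddCommGroup G] [NormedSpace ℂ G] [T0Space G] [CompleteSpace G] {σ : ℂ →+* ℂ}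
    (f : E →SL[σ] G) (x : E) : extendCLM f (x : UniformSpace.Completion E) = f x :=
  ContinuousLinearMap.extend_eq f UniformSpace.Completion.denseRange_coe
    (UniformSpace.Completion.isUniformInducing_coe E) x

/-- Extension by continuity of a bounded bilinear (or sesquilinear) map to the completions. -/
def extendCLM₂ {E F G : Type*} [SeminormedAddCommGroup E] [NormedSpace ℂ E]
    [SeminormedAddCommGroup F] [NormedSpace ℂ F] [NormedAddCommGroup G]
    [NormedSpace ℂ G] [CompleteSpace G] {σ : ℂ →+* ℂ} [RingHomIsometric σ]
    (f : E →SL[σ] F →L[ℂ] G) :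
    UniformSpace.Completion E →SL[σ] UniformSpace.Completion F →L[ℂ] G :=
  let g : UniformSpace.Completion E →SL[σ] F →L[ℂ] G := extendCLM f
  let h : UniformSpace.Completion F →L[ℂ] UniformSpace.Completion E →SL[σ] G := extendCLM g.flip
  h.flip

lemma extendCLM₂_coe {E F G : Type*} [SeminormedAddCommGroup E] [NormedSpace ℂ E]
    [SeminormedAddCommGroup F] [NormedSpace ℂ F] [NormedAddCommGroup G]
    [NormedSpace ℂ G] [CompleteSpace G] {σ : ℂ →+* ℂ} [RingHomIsometric σ]
    (f : E →SL[σ] F →L[ℂ] G) (x : E) (y : F) :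
    extendCLM₂ f (x : UniformSpace.Completion E) (y : UniformSpace.Completion F) = f x y := by
  simp only [extendCLM₂, ContinuousLinearMap.flip_apply, extendCLM_coe]

variable (D) in
/-- The `A`-valued inner product of `M_s`, conjugate linear in the first variable: the continuous
extension of `⟨x, y⟩_s = L_s (x^* y)`. -/
def inner (s : S) : D.Fiber s →L⋆[ℂ] D.Fiber s →L[ℂ] A :=
  extendCLM₂ <| LinearMap.mkContinuous₂
    (LinearMap.mk₂'ₛₗ (starRingEnd ℂ) (RingHom.id ℂ) (D.preInner s)
      (fun x y z => by simp [preInner, add_mul])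
      (fun c x y => by simp [preInner, smul_mul_assoc])
      (fun x y z => by simp [preInner, mul_add])
      (fun c x y => by simp [preInner, mul_smul_comm]))
    1 (fun x y => (norm_preInner_le s x y).trans_eq (by rw [one_mul]))

lemma inner_coe (s : S) (x y : D.PreFiber s) :
    D.inner s (x : D.Fiber s) (y : D.Fiber s) = D.L s (star (D.incl s x) * D.incl s y) := by
  rw [inner, extendCLM₂_coe]
  rfl

variable (D) in
/-- `x · a = x α_s(a)` on `A_s`. -/
def preRight (s : S) (a : A) : D.PreFiber s →ₗ[ℂ] D.PreFiber s where
  toFun x := ⟨D.incl s x * D.α s a, D.mul_alpha_mem s _ a⟩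
  map_add' x y := Subtype.ext (by
    change D.incl s (x + y) * D.α s a = D.incl s x * D.α s a + D.incl s y * D.α s a
    rw [map_add, add_mul])
  map_smul' c x := Subtype.ext (by
    change D.incl s (c • x) * D.α s a = c • (D.incl s x * D.α s a)
    rw [map_smul, smul_mul_assoc])

variable (D) in
/-- `a · x = a x` on `A_s`. -/
def preLeft (s : S) (a : A) : D.PreFiber s →ₗ[ℂ] D.PreFiber s where
  toFun x := ⟨a * D.incl s x, D.left_mul_mem a (D.incl_mem s x)⟩
  map_add' x y := Subtype.ext (by
    change a * D.incl s (x + y) = a * D.incl s x + a * D.incl s y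
    rw [map_add, mul_add])
  map_smul' c x := Subtype.ext (by
    change a * D.incl s (c • x) = c • (a * D.incl s x)
    rw [map_smul, mul_smul_comm])

variable (D) in
/-- The product `A_s × A_t → A_{s+t}`, `(x, y) ↦ x α_s(y)`.  For `x = a αBar_s(1)` and
`y = b αBar_t(1)` this is `a α_s(b αBar_t(1))`, since `αBar_s(1) α_s(y) = α_s(y)`. -/
def preMul (s t : S) : D.PreFiber s →ₗ[ℂ] D.PreFiber t →ₗ[ℂ] D.PreFiber (s + t) :=
  LinearMap.mk₂ ℂ
    (fun x y => ⟨D.incl s x * D.α s (D.incl t y), D.mul_alpha_mem_add s t _ (D.incl_mem t y)⟩)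
    (fun x y z => Subtype.ext (by
      change D.incl s (x + y) * _ = D.incl s x * _ + D.incl s y * _
      rw [map_add, add_mul]))
    (fun c x y => Subtype.ext (by
      change D.incl s (c • x) * _ = c • (D.incl s x * _)
      rw [map_smul, smul_mul_assoc]))
    (fun x y z => Subtype.ext (by
      change _ * D.α s (D.incl t (y + z)) = _ * D.α s (D.incl t y) + _ * D.α s (D.incl t z)
      rw [map_add, map_add, mul_add]))
    (fun c x y => Subtype.ext (by
      change _ * D.α s (D.incl t (c • y)) = c • (_ * D.α s (D.incl t y))
      rw [map_smul, map_smul, mul_smul_comm]))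

lemma incl_preMul (s t : S) (x : D.PreFiber s) (y : D.PreFiber t) :
    D.incl (s + t) (D.preMul s t x y) = D.incl s x * D.α s (D.incl t y) := rfl

lemma norm_preRight_le (s : S) (a : A) (x : D.PreFiber s) :
    ‖D.preRight s a x‖ ≤ ‖a‖ * ‖x‖ := by
  refine le_of_sq_le_sq ?_ (by positivity)
  have h : D.preInner s (D.preRight s a x) (D.preRight s a x) =
      star a * D.preInner s x x * a := by
    change D.L s (star (D.incl s x * D.α s a) * (D.incl s x * D.α s a)) = _
    rw [star_mul, ← map_star, mul_assoc, L_alpha_mul, ← mul_assoc (star (D.incl s x)),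
      L_mul_alpha, mul_assoc]
    rfl
  rw [preFiber_norm_sq, h, mul_pow, preFiber_norm_sq]
  calc _ ≤ ‖star a‖ * ‖D.preInner s x x‖ * ‖a‖ := norm_mul₃_le
    _ = _ := by rw [norm_star]; ring

lemma norm_preLeft_le (s : S) (a : A) (x : D.PreFiber s) :
    ‖D.preLeft s a x‖ ≤ ‖a‖ * ‖x‖ := by
  refine le_of_sq_le_sq ?_ (by positivity)
  have h1 : star (a * D.incl s x) * (a * D.incl s x) ≤
      ‖star a * a‖ • (star (D.incl s x) * D.incl s x) := by
    have := CStarAlgebra.star_left_conjugate_le_norm_smul (a := D.incl s x) (b := star a * a)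
      (hb := .star_mul_self a)
    simpa only [star_mul, mul_assoc] using this
  have h2 : D.preInner s (D.preLeft s a x) (D.preLeft s a x) ≤
      ‖star a * a‖ • D.preInner s x x := by
    have h3 := D.L_nonneg s _ (sub_nonneg.2 h1)
    rw [map_sub, sub_nonneg, ← Complex.coe_smul, map_smul, Complex.coe_smul] at h3
    exact h3
  have h4 := CStarAlgebra.norm_le_norm_of_nonneg_of_le (preInner_self_nonneg s _) h2
  rwa [norm_smul, norm_norm, CStarRing.norm_star_mul_self, ← preFiber_norm_sq,
    ← preFiber_norm_sq, ← sq, ← mul_pow] at h4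

lemma norm_preMul_le (s t : S) (x : D.PreFiber s) (y : D.PreFiber t) :
    ‖D.preMul s t x y‖ ≤ ‖x‖ * ‖y‖ := by
  refine le_of_sq_le_sq ?_ (by positivity)
  have h1 : D.preInner (s + t) (D.preMul s t x y) (D.preMul s t x y) =
      D.L t (star (D.incl t y) * D.preInner s x x * D.incl t y) := by
    rw [preInner, incl_preMul, add_comm s t, D.L_add, star_mul, ← map_star, mul_assoc,
      L_alpha_mul, ← mul_assoc (star (D.incl s x)), L_mul_alpha, mul_assoc]
    rfl
  have h2 : D.preInner (s + t) (D.preMul s t x y) (D.preMul s t x y) ≤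
      ‖D.preInner s x x‖ • D.preInner t y y := by
    have h3 := D.L_nonneg t _ (sub_nonneg.2 (CStarAlgebra.star_left_conjugate_le_norm_smul
      (a := D.incl t y) (b := D.preInner s x x) (hb := .of_nonneg (preInner_self_nonneg s x))))
    rw [map_sub, sub_nonneg, ← Complex.coe_smul, map_smul, Complex.coe_smul] at h3
    rw [h1]
    exact h3
  have h4 := CStarAlgebra.norm_le_norm_of_nonneg_of_le (preInner_self_nonneg _ _) h2
  rwa [norm_smul, norm_norm, ← preFiber_norm_sq, ← preFiber_norm_sq, ← preFiber_norm_sq,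
    ← mul_pow] at h4

variable (D) in
/-- The right action `x · a` of `a ∈ A` on `M_s`. -/
def right (s : S) (a : A) : D.Fiber s →L[ℂ] D.Fiber s :=
  extendCLM (UniformSpace.Completion.toComplL.comp
    ((D.preRight s a).mkContinuous ‖a‖ (norm_preRight_le s a)))

variable (D) in
/-- The left action `φ_s(a) x = a · x` of `a ∈ A` on `M_s`. -/
def left (s : S) (a : A) : D.Fiber s →L[ℂ] D.Fiber s :=
  extendCLM (UniformSpace.Completion.toComplL.comp
    ((D.preLeft s a).mkContinuous ‖a‖ (norm_preLeft_le s a)))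

variable (D) in
/-- The multiplication `M_s × M_t → M_{s+t}`, the continuous extension of `(x, y) ↦ x α_s(y)`. -/
def fiberMul (s t : S) : D.Fiber s →L[ℂ] D.Fiber t →L[ℂ] D.Fiber (s + t) :=
  extendCLM₂ <| LinearMap.mkContinuous₂
    ((D.preMul s t).compr₂ (UniformSpace.Completion.toComplL :
      D.PreFiber (s + t) →L[ℂ] D.Fiber (s + t)).toLinearMap)
    1 (fun x y => by
      rw [one_mul]
      exact (UniformSpace.Completion.norm_coe (D.preMul s t x y)).trans_le
        (norm_preMul_le s t x y))

lemma right_coe (s : S) (a : A) (x : D.PreFiber s) :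
    D.right s a (x : D.Fiber s) = (D.preRight s a x : D.PreFiber s) := by
  rw [right, extendCLM_coe]
  rfl

lemma left_coe (s : S) (a : A) (x : D.PreFiber s) :
    D.left s a (x : D.Fiber s) = (D.preLeft s a x : D.PreFiber s) := by
  rw [left, extendCLM_coe]
  rfl

lemma fiberMul_coe (s t : S) (x : D.PreFiber s) (y : D.PreFiber t) :
    D.fiberMul s t (x : D.Fiber s) (y : D.Fiber t) = (D.preMul s t x y : D.PreFiber (s + t)) := by
  rw [fiberMul, extendCLM₂_coe]
  rfl

variable (D) in
/-- The element `a αBar_s(1)` of `A_s`, for `a ∈ A`. -/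
def toPreFiber (s : S) (a : A) : D.PreFiber s :=
  ⟨(D.αBar s 1).snd a, LinearMap.mem_range_self _ a⟩

variable (D) in
/-- The class in `M_s` of the element `a αBar_s(1)` of `A_s`, for `a ∈ A`.  If already `a ∈ A_s`
(for instance if `a = α_s(b)`), it is the class of `a`.  For `s = 0` it is the class of `a`, and
`toFiber 0` is the identification of `A` with `X_0`. -/
def toFiber (s : S) (a : A) : D.Fiber s := (D.toPreFiber s a : D.Fiber s)

/-! ### The product system and its Toeplitz algebra -/

variable (D) in
/-- The product system `X = ⨆ {s} × M_s`. -/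
def ProductSystem : Type (max u v) := Σ s : S, D.Fiber s

instance : Mul D.ProductSystem :=
  ⟨fun x y => ⟨x.1 + y.1, D.fiberMul x.1 y.1 x.2 y.2⟩⟩

/-- Toeplitz representations `ψ : X → B` of the product system `X` in a `C*`-algebra `B`. -/
structure IsToeplitzRep {B : Type*} [NonUnitalCStarAlgebra B] (ψ : D.ProductSystem → B) :
    Prop where
  map_mul : ∀ x y, ψ (x * y) = ψ x * ψ y
  map_add : ∀ s (x y : D.Fiber s), ψ ⟨s, x + y⟩ = ψ ⟨s, x⟩ + ψ ⟨s, y⟩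
  map_smul : ∀ s (c : ℂ) (x : D.Fiber s), ψ ⟨s, c • x⟩ = c • ψ ⟨s, x⟩
  hom_zero : ∃ ψ₀ : A →⋆ₙₐ[ℂ] B, ∀ a, ψ₀ a = ψ ⟨0, D.toFiber 0 a⟩
  map_right : ∀ s (x : D.Fiber s) (a : A),
    ψ ⟨s, D.right s a x⟩ = ψ ⟨s, x⟩ * ψ ⟨0, D.toFiber 0 a⟩
  map_inner : ∀ s (x y : D.Fiber s),
    star (ψ ⟨s, x⟩) * ψ ⟨s, y⟩ = ψ ⟨0, D.toFiber 0 (D.inner s x y)⟩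
  map_left : ∀ s (a : A) (x : D.Fiber s),
    ψ ⟨s, D.left s a x⟩ = ψ ⟨0, D.toFiber 0 a⟩ * ψ ⟨s, x⟩

variable (D) in
/-- `(T, iX)` is the Toeplitz algebra of the product system `X` with its universal Toeplitz
representation. -/
structure IsToeplitzAlgebra (T : Type (max u v)) [NonUnitalCStarAlgebra T]
    (iX : D.ProductSystem → T) : Prop where
  isToeplitzRep : IsToeplitzRep iX
  generated : Dense (NonUnitalStarAlgebra.adjoin ℂ (Set.range iX) : Set T)
  universal : ∀ (B : Type (max u v)) [NonUnitalCStarAlgebra B] (ψ : D.ProductSystem → B),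
    IsToeplitzRep ψ → ∃ ψ' : T →⋆ₙₐ[ℂ] B, ∀ x, ψ' (iX x) = ψ x

end TransferSystem

/-! ### Toeplitz covariant representations and Toeplitz crossed products -/

/-- A representation on a Hilbert space is non-degenerate. -/
def IsNondegenerateRep {B : Type*} [NonUnitalCStarAlgebra B] {H : Type*} [NormedAddCommGroup H]
    [InnerProductSpace ℂ H] [CompleteSpace H] (σ : B →⋆ₙₐ[ℂ] (H →L[ℂ] H)) : Prop :=
  Dense (Submodule.span ℂ {h : H | ∃ b k, h = σ b k} : Set H)

/-- A homomorphism `A → B` of `C*`-algebras is non-degenerate. -/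
def IsNondegenerateHom {A B : Type*} [NonUnitalCStarAlgebra A] [NonUnitalCStarAlgebra B]
    (φ : A →⋆ₙₐ[ℂ] B) : Prop :=
  Dense (Submodule.span ℂ {c : B | ∃ a b, c = φ a * b} : Set B)

namespace TransferSystem

variable {A : Type u} [NonUnitalCStarAlgebra A] [PartialOrder A] [StarOrderedRing A]
  {S : Type v} [AddCommMonoid S] (D : TransferSystem A S)

/-- `(π, V)` is a Toeplitz covariant representation of `(A, S, α, L)` on `H`. -/
structure IsToeplitzCovariant {H : Type*} [NormedAddCommGroup H]
    [InnerProductSpace ℂ H] [CompleteSpace H] (π : A →⋆ₙₐ[ℂ] (H →L[ℂ] H)) (V : S → H →L[ℂ] H) :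
    Prop where
  nondegenerate : IsNondegenerateRep π
  map_zero : V 0 = 1
  map_add : ∀ s t, V (s + t) = V s * V t
  tc1 : ∀ s a, V s * π a = π (D.α s a) * V s
  tc2 : ∀ s a, star (V s) * π a * V s = π (D.L s a)

/-- `(B, iA, iS)` is a Toeplitz crossed product for `(A, S, α, L)`.  The unital `*`-homomorphism
`σ'` in `covariant` and `universal` is the canonical extension to the multiplier algebra of the
non-degenerate representation `σ` (which has only one such extension). In `generated`,
`(iS s).snd (iA a)` is the product `iA a * iS s`, an element of `B`. -/
structure IsToeplitzCrossedProduct (B : Type (max u v)) [NonUnitalCStarAlgebra B]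
    (iA : A →⋆ₙₐ[ℂ] B) (iS : S → 𝓜(ℂ, B)) : Prop where
  nondegenerate : IsNondegenerateHom iA
  map_zero : iS 0 = 1
  map_add : ∀ s t, iS (s + t) = iS s * iS t
  covariant : ∀ (H : Type (max u v)) [NormedAddCommGroup H] [InnerProductSpace ℂ H]
    [CompleteSpace H] (σ : B →⋆ₙₐ[ℂ] (H →L[ℂ] H)), IsNondegenerateRep σ →
    ∃ σ' : 𝓜(ℂ, B) →⋆ₐ[ℂ] (H →L[ℂ] H), (∀ b : B, σ' (b : 𝓜(ℂ, B)) = σ b) ∧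
      D.IsToeplitzCovariant (σ.comp iA) (fun s => σ' (iS s))
  universal : ∀ (H : Type (max u v)) [NormedAddCommGroup H] [InnerProductSpace ℂ H]
    [CompleteSpace H] (π : A →⋆ₙₐ[ℂ] (H →L[ℂ] H)) (V : S → H →L[ℂ] H),
    D.IsToeplitzCovariant π V →
    ∃ σ : B →⋆ₙₐ[ℂ] (H →L[ℂ] H), IsNondegenerateRep σ ∧ (∀ a, σ (iA a) = π a) ∧
      ∃ σ' : 𝓜(ℂ, B) →⋆ₐ[ℂ] (H →L[ℂ] H), (∀ b : B, σ' (b : 𝓜(ℂ, B)) = σ b) ∧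
        ∀ s, σ' (iS s) = V s
  generated : Dense (NonUnitalStarAlgebra.adjoin ℂ
    {b : B | ∃ a s, b = (iS s).snd (iA a)} : Set B)

end TransferSystem

end

/-! Existence of the Toeplitz algebra is soft. The relation `ψ(x)^* ψ(x) = ψ_0(⟨x, x⟩)` bounds the
norm of each generator in terms of the product system alone, so the generators can be placed in an
`ℓ^∞`-product over enough Toeplitz representations, where they generate the universal one
(`exists_universal_cstarAlgebra`).

The crossed product structure rests on the identities `ψ_s(α_s(u)) i_A(a) = ψ_s(α_s(u a))` and
`i_A(a) ψ_s(α_s(u)) = ψ_s(a α_s(u))`. Both sides converge along a bounded approximate unit, and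
`i_A` is non-degenerate, so the strict limit `i_S(s)` exists (`IsToeplitzRep.exists_multiplier`).
Covariant pairs give Toeplitz representations by `x ↦ π(x) V_s`
(`exists_isToeplitzRep_of_covariant`), and this carries the universal property over.

The hard point is injectivity of `i_A`: for each `a ≠ 0` a covariant pair with `π(a) ≠ 0` is needed.
Such a pair lives on the Hilbert space of a positive definite kernel, `⟪j_s x, j_t y⟫ = K(s,t)(x^*
y)`, with `π(b) j_s x = j_s(b x)` and `V_r j_s x = j_{r+s}(α_r x)`. The relation `V_r^* π(b) V_r =
π(L_r b)` amounts to `K(r+s, r+t) = K(s,t) ∘ L_r`. For cancellative `S` the diagonal kernel `K(s,t)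
= δ_{s,t} φ_s`, with `φ_s = φ ∘ L_s`, would do; this is the Fock construction. But `S` need not be
cancellative, and `r + s = r + t` with `s ≠ t` forces nonzero off-diagonal terms.

The remedy is a canonical choice of `K(s,t)` depending only on the functionals `φ_s` and `φ_t`. For
positive functionals `f`, `g` on a unital algebra, `1` is projected in the GNS space of `f` onto the
closure of the elements `h` with `f(a h) = g(h a)`, and `centralKernel f g` is the functional `f(a
·)` evaluated at this projection. It equals `f` when `f = g`, and it is natural under transfer
operators (`centralKernel_comp`). It is positive definite (`sum_centralKernel_nonneg`): for a
diagonal functional on matrices, the matrix of kernels is the projection of the positive all-ones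
matrix onto the centralizer, and such a projection preserves positivity, like a conditional
expectation. The multiplier algebra supplies the unit when `A` has none. -/

open scoped ComplexOrder InnerProductSpace

universe w

noncomputable section

/-! ### Positive functionals separate points -/

/-- The norm of `1 + c` in a unital `C*`-algebra, for `c` positive. -/
lemma one_add_norm_le_norm_one_add {U : Type*} [CStarAlgebra U] [PartialOrder U]
    [StarOrderedRing U] [Nontrivial U] {c : U} (hc : 0 ≤ c) : 1 + ‖c‖ ≤ ‖1 + c‖ := by
  have h := CStarAlgebra.norm_mem_spectrum_of_nonneg hc
  have h2 : (1 : ℝ) + ‖c‖ ∈ spectrum ℝ (algebraMap ℝ U 1 + c) := by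
    rw [← spectrum.singleton_add_eq]
    exact Set.add_mem_add rfl h
  rw [map_one] at h2
  simpa [abs_of_nonneg (by positivity : 0 ≤ 1 + ‖c‖)] using spectrum.norm_le_norm_of_mem h2

/-- Since `‖1 + c‖` is at least `1 + ‖c‖` in the unitization, a norming functional of `1 + c` must
have real part `1` at `1` and `‖c‖` at `c`. A norm-one functional with real part `1` at `1` has
positive real part on positive elements. -/
lemma exists_positiveLinearMap_ne_zero {A : Type*} [NonUnitalCStarAlgebra A] [PartialOrder A]
    [StarOrderedRing A] {c : A} (hc : 0 ≤ c) (hc0 : c ≠ 0) : ∃ f : A →ₚ[ℂ] ℂ, f c ≠ 0 := by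
  let c' : Unitization ℂ A := (c : Unitization ℂ A)
  have hc' : 0 ≤ c' := Unitization.inr_nonneg_iff.2 hc
  have hcn : ‖c'‖ = ‖c‖ := Unitization.norm_inr (𝕜 := ℂ) c
  have hle := one_add_norm_le_norm_one_add hc'
  have hne : ‖1 + c'‖ ≠ 0 := by
    have := norm_nonneg c'
    linarith
  obtain ⟨g, hg1, hg2⟩ := exists_dual_vector ℂ (1 + c') hne
  have hg : ∀ x, ‖g x‖ ≤ ‖x‖ := fun x => by simpa [hg1] using g.le_opNorm x
  have hre : ∀ x, (g x).re ≤ ‖x‖ := fun x => (Complex.re_le_norm _).trans (hg x)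
  have hg3 : (g 1).re + (g c').re = ‖1 + c'‖ := by
    rw [← Complex.add_re, ← map_add, hg2]; simp
  have h1 : (g 1).re = 1 := le_antisymm (by simpa using hre 1) (by linarith [hre c'])
  have h2 : (g c').re = ‖c‖ := le_antisymm (hcn ▸ hre c') (by
    have := hre 1
    rw [CStarRing.norm_one] at this
    linarith)
  -- Symmetrizing makes the functional equal to the real part of `g` on self-adjoint elements.
  let f : A →ₗ[ℂ] ℂ :=
    { toFun a := (g a + star (g (star a : A))) / 2
      map_add' a b := by simp; ring
      map_smul' z a := by simp; ring }
  have hf : ∀ a, f a = (g a + star (g (star a : A))) / 2 := fun _ => rfl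
  have hfsa : ∀ a, IsSelfAdjoint a → f a = (g a).re := fun a ha => by
    rw [hf, ha.star_eq]
    exact (Complex.re_eq_add_conj _).symm
  refine ⟨PositiveLinearMap.mk₀ f fun a ha => ?_, ?_⟩
  · rw [hfsa a ha.isSelfAdjoint]
    suffices h : 0 ≤ (g (a : Unitization ℂ A)).re by exact_mod_cast h
    rcases eq_or_ne a 0 with rfl | ha0
    · simp
    have hpos : 0 < ‖a‖ := norm_pos_iff.2 ha0
    set b : Unitization ℂ A := (a : Unitization ℂ A) with hb
    have hbn : ‖b‖ = ‖a‖ := Unitization.norm_inr (𝕜 := ℂ) a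
    have hb0 : 0 ≤ b := Unitization.inr_nonneg_iff.2 ha
    have hle : b ≤ algebraMap ℝ _ ‖a‖ := by
      rw [← hbn]
      exact IsSelfAdjoint.le_algebraMap_norm_self (hb0.isSelfAdjoint)
    -- From `0 ≤ ‖a‖ - a ≤ ‖a‖` the real part of `g (‖a‖ - a)` is at most `‖a‖`; subtracting `Re g 1
    -- = 1` times `‖a‖` leaves `0 ≤ Re g(a)`.
    have h4 : ‖algebraMap ℝ (Unitization ℂ A) ‖a‖ - b‖ ≤ ‖a‖ := by
      refine (CStarAlgebra.norm_le_norm_of_nonneg_of_le (b := algebraMap ℝ _ ‖a‖)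
        (sub_nonneg.2 hle) (sub_le_self _ hb0)).trans ?_
      simp
    have h5 := (hre _).trans h4
    rw [map_sub, Complex.sub_re, Algebra.algebraMap_eq_smul_one, ← Complex.coe_smul, map_smul,
      smul_eq_mul, Complex.re_ofReal_mul, h1] at h5
    linarith
  · change f c ≠ 0
    rw [hfsa c hc.isSelfAdjoint, h2]
    simpa using hc0

/-! ### The centralizer kernel of a pair of positive functionals -/

namespace PositiveLinearMap

variable {M : Type*} [CStarAlgebra M] [PartialOrder M] [StarOrderedRing M]

/-- The canonical map of a `C*`-algebra into the GNS space of a positive functional. -/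
def gnsMap (f : M →ₚ[ℂ] ℂ) : M →ₗ[ℂ] f.GNS where
  toFun a := (f.toPreGNS a : f.GNS)
  map_add' a b := by rw [map_add, UniformSpace.Completion.coe_add]
  map_smul' c a := by rw [map_smul, UniformSpace.Completion.coe_smul, RingHom.id_apply]

lemma inner_gnsMap (f : M →ₚ[ℂ] ℂ) (a b : M) : ⟪f.gnsMap a, f.gnsMap b⟫_ℂ = f (star a * b) :=
  UniformSpace.Completion.inner_coe _ _

lemma norm_gnsMap_sq (f : M →ₚ[ℂ] ℂ) (a : M) : ‖f.gnsMap a‖ ^ 2 = (f (star a * a)).re := by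
  rw [← inner_gnsMap, ← inner_self_eq_norm_sq (𝕜 := ℂ)]
  rfl

lemma norm_gnsMap_mul_le (f : M →ₚ[ℂ] ℂ) (a b : M) :
    ‖f.gnsMap (a * b)‖ ≤ ‖a‖ * ‖f.gnsMap b‖ := by
  have h : f.gnsNonUnitalStarAlgHom a (f.gnsMap b) = f.gnsMap (a * b) :=
    f.gnsNonUnitalStarAlgHom_apply_coe
  rw [← h]
  exact (ContinuousLinearMap.le_opNorm _ _).trans
    (mul_le_mul_of_nonneg_right (NonUnitalStarAlgHom.norm_apply_le _ _) (norm_nonneg _))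

/-- The elements `h` with `f (a h) = g (h a)` for all `a`. -/
def intertwiners (f g : M →ₚ[ℂ] ℂ) : Submodule ℂ M where
  carrier := {h | ∀ a, f (a * h) = g (h * a)}
  add_mem' hx hy a := by rw [mul_add, add_mul, map_add, map_add, hx a, hy a]
  zero_mem' a := by simp
  smul_mem' c x hx a := by rw [mul_smul_comm, smul_mul_assoc, map_smul, map_smul, hx a]

lemma star_mem_intertwiners {f g : M →ₚ[ℂ] ℂ} {h : M} (hh : h ∈ intertwiners f g) :
    star h ∈ intertwiners g f := fun a => by
  have := hh (star a)
  rw [← star_star (star a * h), ← star_star (h * star a), map_star f, map_star g] at this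
  simpa using (star_injective this).symm

lemma one_mem_intertwiners (f : M →ₚ[ℂ] ℂ) : (1 : M) ∈ intertwiners f f := fun a => by simp

/-- The closure of the image of the intertwiners in the GNS space. -/
def intertwinerSpace (f g : M →ₚ[ℂ] ℂ) : Submodule ℂ f.GNS :=
  ((intertwiners f g).map f.gnsMap).topologicalClosure

instance (f g : M →ₚ[ℂ] ℂ) : CompleteSpace (intertwinerSpace f g) :=
  (Submodule.isClosed_topologicalClosure _).completeSpace_coe

/-- The projection of the cyclic vector to the closure of the intertwiners. -/
def centralVec (f g : M →ₚ[ℂ] ℂ) : f.GNS := (intertwinerSpace f g).starProjection (f.gnsMap 1)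

lemma gnsMap_mem_intertwinerSpace {f g : M →ₚ[ℂ] ℂ} {h : M} (hh : h ∈ intertwiners f g) :
    f.gnsMap h ∈ intertwinerSpace f g :=
  Submodule.le_topologicalClosure _ (Submodule.mem_map_of_mem hh)

lemma inner_centralVec {f g : M →ₚ[ℂ] ℂ} {h : M} (hh : h ∈ intertwiners f g) :
    ⟪f.gnsMap h, centralVec f g⟫_ℂ = f (star h) := by
  rw [centralVec, ← Submodule.inner_starProjection_left_eq_right,
    Submodule.starProjection_eq_self_iff.2 (gnsMap_mem_intertwinerSpace hh), inner_gnsMap, mul_one]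

lemma centralVec_mem (f g : M →ₚ[ℂ] ℂ) : centralVec f g ∈ intertwinerSpace f g :=
  Submodule.starProjection_apply_mem _ _

/-- This characterization of the projection is used three times: for equal functionals, for
adjoints, and for images under `α`. -/
lemma eq_centralVec {f g : M →ₚ[ℂ] ℂ} {ξ : f.GNS} (hξ : ξ ∈ intertwinerSpace f g)
    (h : ∀ h ∈ intertwiners f g, ⟪f.gnsMap h, ξ⟫_ℂ = f (star h)) : ξ = centralVec f g := by
  refine (Submodule.eq_starProjection_of_mem_of_inner_eq_zero hξ fun w hw => ?_).symm
  have hcl : IsClosed {w : f.GNS | ⟪f.gnsMap 1 - ξ, w⟫_ℂ = 0} :=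
    isClosed_eq (by fun_prop) continuous_const
  refine closure_minimal ?_ hcl hw
  rintro _ ⟨y, hy, rfl⟩
  have h1 := h y hy
  rw [Set.mem_ofPred_eq, ← inner_conj_symm, inner_sub_right, h1, inner_gnsMap, mul_one, sub_self,
    map_zero]

lemma exists_tendsto_centralVec (f g : M →ₚ[ℂ] ℂ) : ∃ c : ℕ → M,
    (∀ n, c n ∈ intertwiners f g) ∧ Tendsto (fun n => f.gnsMap (c n)) atTop
      (𝓝 (centralVec f g)) := by
  obtain ⟨x, hx, hlim⟩ := mem_closure_iff_seq_limit.1 (centralVec_mem f g)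
  choose c hc hcx using hx
  exact ⟨c, hc, by simpa [hcx] using hlim⟩

/-- The functional `a ↦ lim f (a c)`, with `c` in the intertwiners approximating the
projection of `1`. -/
def centralKernel (f g : M →ₚ[ℂ] ℂ) : M →ₗ[ℂ] ℂ where
  toFun a := ⟪f.gnsMap (star a), centralVec f g⟫_ℂ
  map_add' a b := by rw [star_add, map_add, inner_add_left]
  map_smul' c a := by simp [star_smul, map_smul, inner_smul_left]

lemma centralKernel_apply (f g : M →ₚ[ℂ] ℂ) (a : M) :
    centralKernel f g a = ⟪f.gnsMap (star a), centralVec f g⟫_ℂ := rfl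

lemma tendsto_centralKernel {f g : M →ₚ[ℂ] ℂ} {c : ℕ → M}
    (hc : Tendsto (fun n => f.gnsMap (c n)) atTop (𝓝 (centralVec f g))) (a : M) :
    Tendsto (fun n => f (a * c n)) atTop (𝓝 (centralKernel f g a)) := by
  have : ∀ n, f (a * c n) = ⟪f.gnsMap (star a), f.gnsMap (c n)⟫_ℂ := fun n => by
    rw [inner_gnsMap, star_star]
  simp only [this]
  exact Tendsto.inner tendsto_const_nhds hc

lemma centralKernel_self (f : M →ₚ[ℂ] ℂ) (a : M) : centralKernel f f a = f a := by
  have : f.gnsMap 1 = centralVec f f :=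
    eq_centralVec (gnsMap_mem_intertwinerSpace (one_mem_intertwiners f)) fun h _ => by
      rw [inner_gnsMap, mul_one]
  rw [centralKernel_apply, ← this, inner_gnsMap, mul_one, star_star]

lemma norm_gnsMap_star {f g : M →ₚ[ℂ] ℂ} {h : M} (hh : h ∈ intertwiners f g) :
    ‖g.gnsMap (star h)‖ = ‖f.gnsMap h‖ := by
  rw [← sq_eq_sq₀ (norm_nonneg _) (norm_nonneg _), norm_gnsMap_sq, norm_gnsMap_sq, star_star,
    hh (star h)]

/-- The adjoint maps intertwiners of `(f, g)` isometrically onto intertwiners of `(g, f)`, as `f(h^*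
h) = g(h h^*)`. Hence the sequence of adjoints is Cauchy, and its limit has the inner products that
determine the projection. Hermitian symmetry of the kernel follows. -/
lemma tendsto_gnsMap_star {f g : M →ₚ[ℂ] ℂ} {c : ℕ → M} (hc : ∀ n, c n ∈ intertwiners f g)
    (hlim : Tendsto (fun n => f.gnsMap (c n)) atTop (𝓝 (centralVec f g))) :
    Tendsto (fun n => g.gnsMap (star (c n))) atTop (𝓝 (centralVec g f)) := by
  have hcau : CauchySeq (fun n => g.gnsMap (star (c n))) := by
    have h1 := hlim.cauchySeq
    rw [Metric.cauchySeq_iff] at h1 ⊢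
    intro ε hε
    obtain ⟨N, hN⟩ := h1 ε hε
    refine ⟨N, fun m hm n hn => ?_⟩
    have := hN m hm n hn
    rwa [dist_eq_norm, ← map_sub, ← star_sub,
      norm_gnsMap_star (sub_mem (hc m) (hc n)), map_sub, ← dist_eq_norm]
  obtain ⟨ξ, hξ⟩ := cauchySeq_tendsto_of_complete hcau
  suffices h : ξ = centralVec g f by rwa [← h]
  refine eq_centralVec ?_ fun h hh => ?_
  · exact (Submodule.isClosed_topologicalClosure _).mem_of_tendsto hξ
      (Eventually.of_forall fun n => gnsMap_mem_intertwinerSpace (star_mem_intertwiners (hc n)))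
  · have h1 : Tendsto (fun n => ⟪g.gnsMap h, g.gnsMap (star (c n))⟫_ℂ) atTop
        (𝓝 ⟪g.gnsMap h, ξ⟫_ℂ) := Tendsto.inner tendsto_const_nhds hξ
    have hs := star_mem_intertwiners hh
    have h2 : Tendsto (fun n => star ⟪f.gnsMap (star h), f.gnsMap (c n)⟫_ℂ) atTop
        (𝓝 (star ⟪f.gnsMap (star h), centralVec f g⟫_ℂ)) :=
      (Tendsto.inner tendsto_const_nhds hlim).star
    rw [inner_centralVec hs, star_star] at h2
    have h3 : star (f h) = g (star h) := by
      rw [← map_star f]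
      have := hs 1
      simpa using this
    rw [← h3]
    refine tendsto_nhds_unique h1 (h2.congr fun n => ?_)
    rw [inner_gnsMap, inner_gnsMap, star_star, hc n h, ← map_star g, star_mul]

lemma star_centralKernel (f g : M →ₚ[ℂ] ℂ) (a : M) :
    star (centralKernel f g a) = centralKernel g f (star a) := by
  obtain ⟨c, hc, hlim⟩ := exists_tendsto_centralVec f g
  have h1 := (tendsto_centralKernel hlim a).star
  have h2 := tendsto_centralKernel (tendsto_gnsMap_star hc hlim) (star a)
  refine tendsto_nhds_unique h1 (h2.congr fun n => ?_)
  rw [← star_mul, map_star g, hc n a]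

/-- Naturality of the kernel under transfer operators. -/
lemma centralKernel_comp {f g f' g' : M →ₚ[ℂ] ℂ} {L : M →ₗ[ℂ] M} {α : M →⋆ₙₐ[ℂ] M}
    (hf : ∀ a, f' a = f (L a)) (hg : ∀ a, g' a = g (L a))
    (hL : ∀ a b, L (α a * b) = a * L b) (hR : ∀ a b, L (b * α a) = L b * a) (a : M) :
    centralKernel f' g' a = centralKernel f g (L a) := by
  obtain ⟨c, hc, hlim⟩ := exists_tendsto_centralVec f g
  have hα : ∀ h ∈ intertwiners f g, α h ∈ intertwiners f' g' := fun h hh a => by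
    rw [hf, hg, hL, hR, hh]
  -- The GNS adjoint of `x ↦ α x` is `y ↦ (L (y^*))^*`. Both maps preserve intertwiners, so `α`
  -- carries one projected vector to the other.
  have hL' : ∀ h ∈ intertwiners f' g', star (L (star h)) ∈ intertwiners f g := fun h hh => by
    refine star_mem_intertwiners fun a => ?_
    rw [← hL, ← hR, ← hf, ← hg, star_mem_intertwiners hh]
  -- `L (α(x)^* α(x)) = x^* L(1) x`, so `α` is bounded between the GNS spaces even when it is not
  -- unital.
  have hnorm : ∀ x, ‖f'.gnsMap (α x)‖ ^ 2 ≤ ‖L 1‖ * ‖f.gnsMap x‖ ^ 2 := fun x => by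
    have h1 : f' (star (α x) * α x) = ⟪f.gnsMap x, f.gnsMap (L 1 * x)⟫_ℂ := by
      rw [inner_gnsMap, hf, ← map_star, hL, ← hR, one_mul]
    rw [norm_gnsMap_sq, h1]
    calc _ ≤ ‖⟪f.gnsMap x, f.gnsMap (L 1 * x)⟫_ℂ‖ := Complex.re_le_norm _
      _ ≤ ‖f.gnsMap x‖ * ‖f.gnsMap (L 1 * x)‖ := norm_inner_le_norm _ _
      _ ≤ ‖f.gnsMap x‖ * (‖L 1‖ * ‖f.gnsMap x‖) := by gcongr; exact norm_gnsMap_mul_le ..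
      _ = _ := by ring
  have hnorm' : ∀ x, ‖f'.gnsMap (α x)‖ ≤ √‖L 1‖ * ‖f.gnsMap x‖ := fun x => by
    refine le_of_sq_le_sq ?_ (by positivity)
    rw [mul_pow, Real.sq_sqrt (norm_nonneg _)]
    exact hnorm x
  have hcau : CauchySeq (fun n => f'.gnsMap (α (c n))) := by
    have h1 := hlim.cauchySeq
    rw [Metric.cauchySeq_iff] at h1 ⊢
    intro ε hε
    obtain ⟨N, hN⟩ := h1 (ε / (√‖L 1‖ + 1)) (by positivity)
    refine ⟨N, fun m hm n hn => ?_⟩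
    have h2 := hN m hm n hn
    rw [dist_eq_norm, ← map_sub] at h2 ⊢
    rw [← map_sub]
    refine (hnorm' _).trans_lt ?_
    rw [lt_div_iff₀ (by positivity)] at h2
    nlinarith [norm_nonneg (f.gnsMap (c m - c n))]
  obtain ⟨ξ, hξ⟩ := cauchySeq_tendsto_of_complete hcau
  have hinner : ∀ y n, ⟪f'.gnsMap y, f'.gnsMap (α (c n))⟫_ℂ =
      ⟪f.gnsMap (star (L (star y))), f.gnsMap (c n)⟫_ℂ := fun y n => by
    rw [inner_gnsMap, inner_gnsMap, hf, hR, star_star]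
  have hlim2 : ∀ y, ⟪f'.gnsMap y, ξ⟫_ℂ =
      ⟪f.gnsMap (star (L (star y))), centralVec f g⟫_ℂ := fun y => by
    have h1 : Tendsto (fun n => ⟪f'.gnsMap y, f'.gnsMap (α (c n))⟫_ℂ) atTop
        (𝓝 ⟪f'.gnsMap y, ξ⟫_ℂ) := Tendsto.inner tendsto_const_nhds hξ
    have h2 : Tendsto (fun n => ⟪f.gnsMap (star (L (star y))), f.gnsMap (c n)⟫_ℂ) atTop
        (𝓝 ⟪f.gnsMap (star (L (star y))), centralVec f g⟫_ℂ) :=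
      Tendsto.inner tendsto_const_nhds hlim
    exact tendsto_nhds_unique h1 (h2.congr fun n => (hinner y n).symm)
  have hξ' : ξ = centralVec f' g' := by
    refine eq_centralVec ?_ fun h hh => ?_
    · exact (Submodule.isClosed_topologicalClosure _).mem_of_tendsto hξ
        (Eventually.of_forall fun n => gnsMap_mem_intertwinerSpace (hα _ (hc n)))
    · rw [hlim2, inner_centralVec (hL' h hh), star_star, hf]
  rw [centralKernel_apply, ← hξ', hlim2, star_star, centralKernel_apply]

end PositiveLinearMap

/-- A self-adjoint element of a closed `*`-subalgebra is the difference of two orthogonal squares of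
self-adjoint elements of the subalgebra. -/
lemma exists_sq_sub_sq {N : Type*} [NonUnitalCStarAlgebra N] (𝒞 : NonUnitalStarSubalgebra ℂ N)
    [IsClosed (𝒞 : Set N)] {c : N} (hc : star c = c) (hcm : c ∈ 𝒞) :
    ∃ p ∈ 𝒞, ∃ n ∈ 𝒞, star p = p ∧ star n = n ∧ c = p * p - n * n ∧ n * n * (p * p) = 0 := by
  let := CStarAlgebra.spectralOrder N
  let := CStarAlgebra.spectralOrderedRing N
  have hsa : IsSelfAdjoint c := hc
  have key : ∀ q : N, q ∈ 𝒞 → 0 ≤ q → ∃ p ∈ 𝒞, star p = p ∧ p * p = q := fun q hq hq0 => by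
    refine ⟨cfcₙ Real.sqrt q, cfcₙ_mem _ hq, ?_, ?_⟩
    · rw [← CFC.sqrt_eq_real_sqrt q hq0]
      exact (CFC.sqrt_nonneg q).isSelfAdjoint
    · rw [← CFC.sqrt_eq_real_sqrt q hq0, CFC.sqrt_mul_sqrt_self q hq0]
  obtain ⟨p, hp, hps, hpp⟩ := key c⁺ (cfcₙ_mem _ hcm) (CFC.posPart_nonneg c)
  obtain ⟨n, hn, hns, hnn⟩ := key c⁻ (cfcₙ_mem _ hcm) (CFC.negPart_nonneg c)
  refine ⟨p, hp, n, hn, hps, hns, ?_, ?_⟩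
  · rw [hpp, hnn, CFC.posPart_sub_negPart c hsa]
  · rw [hpp, hnn, CFC.negPart_mul_posPart c]

/-! ### Positive definiteness of the centralizer kernel, through matrices. -/

namespace PositiveLinearMap

variable {M : Type*} [CStarAlgebra M] [PartialOrder M] [StarOrderedRing M]
  {ι : Type*} [Fintype ι] [DecidableEq ι]

/-- The positive functional on matrices given by a family of positive functionals on the
diagonal. -/
def diagFunctional (f : ι → M →ₚ[ℂ] ℂ) : CStarMatrix ι ι M →ₗ[ℂ] ℂ where
  toFun Y := ∑ i, f i (Y i i)
  map_add' Y Z := by simp [Finset.sum_add_distrib]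
  map_smul' c Y := by simp [Finset.mul_sum]

lemma diagFunctional_apply (f : ι → M →ₚ[ℂ] ℂ) (Y : CStarMatrix ι ι M) :
    diagFunctional f Y = ∑ i, f i (Y i i) := rfl

lemma diagFunctional_mul (f : ι → M →ₚ[ℂ] ℂ) (Y Z : CStarMatrix ι ι M) :
    diagFunctional f (Y * Z) =
      ∑ i, ∑ j, ⟪(f i).gnsMap (star (Y i j)), (f i).gnsMap (Z j i)⟫_ℂ := by
  simp only [diagFunctional_apply, CStarMatrix.mul_apply, map_sum, inner_gnsMap, star_star]

lemma diagFunctional_star (f : ι → M →ₚ[ℂ] ℂ) (Y : CStarMatrix ι ι M) :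
    diagFunctional f (star Y) = star (diagFunctional f Y) := by
  simp only [diagFunctional_apply, CStarMatrix.star_apply, map_star, star_sum]

lemma continuous_diagFunctional (f : ι → M →ₚ[ℂ] ℂ) : Continuous (diagFunctional f) := by
  refine continuous_finsetSum _ fun i _ => (map_continuous (f i)).comp ?_
  exact (continuous_apply_apply i i : Continuous fun Y : ι → ι → M => Y i i)

lemma diagFunctional_star_mul_self (f : ι → M →ₚ[ℂ] ℂ) (Y : CStarMatrix ι ι M) :
    (diagFunctional f (star Y * Y)).re = ∑ i, ∑ j, ‖(f i).gnsMap (Y j i)‖ ^ 2 := by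
  simp only [diagFunctional_mul, CStarMatrix.star_apply, star_star, Complex.re_sum,
    inner_gnsMap, norm_gnsMap_sq]

/-- The centralizer of the diagonal functional. -/
def matrixCentralizer (f : ι → M →ₚ[ℂ] ℂ) : NonUnitalStarSubalgebra ℂ (CStarMatrix ι ι M) where
  carrier := {H | ∀ Y, diagFunctional f (Y * H) = diagFunctional f (H * Y)}
  add_mem' hx hy a := by rw [mul_add, add_mul, map_add, map_add, hx a, hy a]
  zero_mem' a := by simp
  smul_mem' c x hx a := by rw [mul_smul_comm, smul_mul_assoc, map_smul, map_smul, hx a]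
  mul_mem' {x y} hx hy a := by rw [← mul_assoc, hy, ← mul_assoc, hx, mul_assoc]
  star_mem' {x} hx a := by
    have := hx (star a)
    rw [← star_star (star a * x), ← star_star (x * star a), diagFunctional_star f (star _),
      diagFunctional_star f (star _)] at this
    simpa using (star_injective this).symm

lemma mem_matrixCentralizer {f : ι → M →ₚ[ℂ] ℂ} {H : CStarMatrix ι ι M} :
    H ∈ matrixCentralizer f ↔ ∀ Y, diagFunctional f (Y * H) = diagFunctional f (H * Y) := Iff.rfl

instance (f : ι → M →ₚ[ℂ] ℂ) : IsClosed (matrixCentralizer f : Set (CStarMatrix ι ι M)) := by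
  have : (matrixCentralizer f : Set (CStarMatrix ι ι M)) =
      ⋂ Y, {H | diagFunctional f (Y * H) = diagFunctional f (H * Y)} := by
    ext H; simp [mem_matrixCentralizer]
  rw [this]
  have := continuous_diagFunctional f
  exact isClosed_iInter fun Y => isClosed_eq (by fun_prop) (by fun_prop)

lemma mem_matrixCentralizer_of_forall {f : ι → M →ₚ[ℂ] ℂ} {H : CStarMatrix ι ι M}
    (h : ∀ i j, H j i ∈ intertwiners (f i) (f j)) : H ∈ matrixCentralizer f := fun Y => by
  simp only [diagFunctional_apply, CStarMatrix.mul_apply, map_sum]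
  rw [Finset.sum_comm]
  exact Finset.sum_congr rfl fun j _ => Finset.sum_congr rfl fun i _ => h i j _

/-- Testing the centralizer condition against a matrix with the single entry `a` isolates one entry
of `H`. With the converse above, the centralizer consists exactly of the matrices of intertwiners.
-/
lemma apply_mem_intertwiners {f : ι → M →ₚ[ℂ] ℂ} {H : CStarMatrix ι ι M}
    (h : H ∈ matrixCentralizer f) (i j : ι) : H j i ∈ intertwiners (f i) (f j) := fun a => by
  let Y : CStarMatrix ι ι M := CStarMatrix.ofMatrix (Matrix.single i j a)
  have h1 := h Y
  have e1 : diagFunctional f (Y * H) = f i (a * H j i) := by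
    rw [diagFunctional_apply, Finset.sum_eq_single i]
    · rw [CStarMatrix.mul_apply, Finset.sum_eq_single j]
      · simp [Y, CStarMatrix.ofMatrix_apply]
      · intro k _ hk
        simp [Y, CStarMatrix.ofMatrix_apply, hk.symm]
      · simp
    · intro k _ hk
      rw [CStarMatrix.mul_apply]
      simp [Y, CStarMatrix.ofMatrix_apply, hk.symm]
    · simp
  have e2 : diagFunctional f (H * Y) = f j (H j i * a) := by
    rw [diagFunctional_apply, Finset.sum_eq_single j]
    · rw [CStarMatrix.mul_apply, Finset.sum_eq_single i]
      · simp [Y, CStarMatrix.ofMatrix_apply]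
      · intro k _ hk
        simp [Y, CStarMatrix.ofMatrix_apply, hk.symm]
      · simp
    · intro k _ hk
      rw [CStarMatrix.mul_apply]
      simp [Y, CStarMatrix.ofMatrix_apply, hk.symm]
    · simp
  rwa [e1, e2] at h1

/-- One factor `B` can be moved cyclically to the front, which turns the product into `(W B)^* (W
B)`. -/
lemma diagFunctional_mul_nonneg {f : ι → M →ₚ[ℂ] ℂ} {B : CStarMatrix ι ι M}
    (hB : B ∈ matrixCentralizer f) (hBs : star B = B) (W : CStarMatrix ι ι M) :
    0 ≤ (diagFunctional f (star W * W * (B * B))).re := by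
  rw [← mul_assoc, hB, show B * (star W * W * B) = star (W * B) * (W * B) by
    rw [star_mul, hBs]; simp only [mul_assoc], diagFunctional_star_mul_self]
  positivity

lemma exists_star_mul_self_apply (x : ι → M) :
    ∃ W : CStarMatrix ι ι M, ∀ i j, (star W * W) i j = star (x i) * x j := by
  rcases isEmpty_or_nonempty ι with h | ⟨⟨k⟩⟩
  · exact ⟨0, fun i => h.elim i⟩
  · refine ⟨CStarMatrix.ofMatrix (Matrix.of fun i j => if i = k then x j else 0), fun i j => ?_⟩
    rw [CStarMatrix.mul_apply, Finset.sum_eq_single k]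
    · rw [CStarMatrix.star_apply]
      simp [CStarMatrix.ofMatrix_apply]
    · intro l _ hl
      simp [CStarMatrix.ofMatrix_apply, hl]
    · simp

/-- The projected all-ones matrix is a GNS limit of self-adjoint matrices `C n = p² - r²` in the
centralizer. The negative parts `N n = r²` tend to zero in the GNS norm, so only `p²` contributes in
the limit, and it pairs non-negatively with `W^* W`. -/
lemma sum_centralKernel_star_mul_self_nonneg (f : ι → M →ₚ[ℂ] ℂ) (W : CStarMatrix ι ι M) :
    0 ≤ (∑ i, ∑ j, centralKernel (f i) (f j) ((star W * W) i j)).re := by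
  choose c₀ hc₀ hlim₀ using fun i j => exists_tendsto_centralVec (f i) (f j)
  let c : ι → ι → ℕ → M := fun i j n => (1 / 2 : ℂ) • (c₀ i j n + star (c₀ j i n))
  have hc : ∀ i j n, c i j n ∈ intertwiners (f i) (f j) := fun i j n =>
    Submodule.smul_mem _ _ (add_mem (hc₀ i j n) (star_mem_intertwiners (hc₀ j i n)))
  have hlim : ∀ i j, Tendsto (fun n => (f i).gnsMap (c i j n)) atTop
      (𝓝 (centralVec (f i) (f j))) := fun i j => by
    have := ((hlim₀ i j).add (tendsto_gnsMap_star (hc₀ j i) (hlim₀ j i))).const_smul (1 / 2 : ℂ)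
    rw [← two_smul ℂ (centralVec _ _), smul_smul] at this
    norm_num at this
    refine this.congr fun n => ?_
    simp [c]
  let C : ℕ → CStarMatrix ι ι M := fun n => CStarMatrix.ofMatrix fun j i => c i j n
  have hCs : ∀ n, star (C n) = C n := fun n => CStarMatrix.ext fun i j => by
    rw [CStarMatrix.star_apply]
    change star (c i j n) = c j i n
    simp [c, add_comm]
  have hCm : ∀ n, C n ∈ matrixCentralizer f := fun n =>
    mem_matrixCentralizer_of_forall fun i j => hc i j n
  choose p hp r hr hps hrs hCpr hrp using fun n => exists_sq_sub_sq (matrixCentralizer f)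
    (hCs n) (hCm n)
  let N : ℕ → CStarMatrix ι ι M := fun n => r n * r n
  have hNm : ∀ n, N n ∈ matrixCentralizer f := fun n => mul_mem (hr n) (hr n)
  have hNs : ∀ n, star (N n) = N n := fun n => by simp only [N, star_mul, hrs]
  have hNC : ∀ n, N n * C n = -(N n * N n) := fun n => by
    rw [hCpr n, mul_sub, hrp, zero_sub]
  let δ : ℕ → ℝ := fun n => ∑ i, ∑ j, ‖(f i).gnsMap (c i j n) - centralVec (f i) (f j)‖
  have hδ : Tendsto δ atTop (𝓝 0) := by
    have : Tendsto δ atTop (𝓝 (∑ i : ι, ∑ j : ι, (0 : ℝ))) := by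
      refine tendsto_finsetSum _ fun i _ => tendsto_finsetSum _ fun j _ => ?_
      exact tendsto_iff_norm_sub_tendsto_zero.1 (hlim i j)
    simpa using this
  let ν : ℕ → ℝ := fun n => √(∑ i, ∑ j, ‖(f i).gnsMap (N n j i)‖ ^ 2)
  have hν : ∀ n i j, ‖(f i).gnsMap (N n j i)‖ ≤ ν n := fun n i j => by
    refine Real.le_sqrt_of_sq_le ?_
    refine le_trans ?_ (Finset.single_le_sum (f := fun i => ∑ j, ‖(f i).gnsMap (N n j i)‖ ^ 2)
      (fun i _ => by positivity) (Finset.mem_univ i))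
    exact Finset.single_le_sum (f := fun j => ‖(f i).gnsMap (N n j i)‖ ^ 2)
      (fun j _ => by positivity) (Finset.mem_univ j)
  have hν0 : ∀ n, 0 ≤ ν n := fun n => Real.sqrt_nonneg _
  -- `N C = -N²` gives `ν² = -⟪N, C⟫`. The pairing of `N` with the limit of `C` equals its pairing
  -- with the all-ones matrix `O^* O`, hence is non-negative. So `ν² ≤ -⟪N, C - lim C⟫ ≤ ν δ`.
  have hνδ : ∀ n, ν n ≤ δ n := fun n => by
    obtain ⟨O, hO⟩ := exists_star_mul_self_apply (fun _ : ι => (1 : M))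
    have h1 : ν n ^ 2 = (diagFunctional f (star (N n) * N n)).re := by
      rw [diagFunctional_star_mul_self, Real.sq_sqrt (by positivity)]
    have h2 : 0 ≤ (∑ i, ∑ j, ⟪(f i).gnsMap (N n j i), centralVec (f i) (f j)⟫_ℂ).re := by
      have h3 := diagFunctional_mul_nonneg (hr n) (hrs n) O
      rw [hNm n, diagFunctional_apply] at h3
      simp only [CStarMatrix.mul_apply (M := N n), hO, star_one, mul_one, map_sum] at h3
      refine h3.trans_eq (congrArg _ (Finset.sum_congr rfl fun i _ =>
        Finset.sum_congr rfl fun j _ => ?_))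
      rw [inner_centralVec (apply_mem_intertwiners (hNm n) i j), ← CStarMatrix.star_apply, hNs n]
    have h4 : diagFunctional f (star (N n) * N n) =
        -∑ i, ∑ j, ⟪(f i).gnsMap (N n j i), (f i).gnsMap (c i j n)⟫_ℂ := by
      rw [hNs, ← neg_neg (N n * N n), ← hNC, map_neg, diagFunctional_mul]
      simp only [← CStarMatrix.star_apply, hNs]
      rfl
    have h5 : ν n ^ 2 ≤ -(∑ i, ∑ j, ⟪(f i).gnsMap (N n j i),
        (f i).gnsMap (c i j n) - centralVec (f i) (f j)⟫_ℂ).re := by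
      simp only [inner_sub_right, Finset.sum_sub_distrib, Complex.sub_re]
      rw [h1, h4, Complex.neg_re]
      linarith
    have h6 : ν n ^ 2 ≤ ν n * δ n := by
      refine h5.trans ((neg_le_abs _).trans ((Complex.abs_re_le_norm _).trans ?_))
      rw [Finset.mul_sum]
      refine norm_sum_le_of_le _ fun i _ => ?_
      rw [Finset.mul_sum]
      refine norm_sum_le_of_le _ fun j _ => (norm_inner_le_norm _ _).trans ?_
      gcongr
      exact hν n i j
    rcases (hν0 n).eq_or_lt with h | h
    · rw [← h]
      positivity
    · rw [sq] at h6
      exact le_of_mul_le_mul_left h6 h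
  have hmain : ∀ n, -((∑ i, ∑ j, ‖(f i).gnsMap (star ((star W * W) i j))‖) * δ n) ≤
      (∑ i, ∑ j, f i ((star W * W) i j * c i j n)).re := fun n => by
    have h1 : ∑ i, ∑ j, f i ((star W * W) i j * c i j n) =
        diagFunctional f (star W * W * C n) := by
      simp only [diagFunctional_apply, CStarMatrix.mul_apply (M := star W * W), map_sum]
      rfl
    have h2 := diagFunctional_mul_nonneg (hp n) (hps n) W
    have h3 : ‖diagFunctional f (star W * W * N n)‖ ≤
        (∑ i, ∑ j, ‖(f i).gnsMap (star ((star W * W) i j))‖) * δ n := by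
      rw [diagFunctional_mul, Finset.sum_mul]
      refine norm_sum_le_of_le _ fun i _ => ?_
      rw [Finset.sum_mul]
      refine norm_sum_le_of_le _ fun j _ => (norm_inner_le_norm _ _).trans ?_
      gcongr
      exact (hν n i j).trans (hνδ n)
    rw [h1, hCpr n, mul_sub, map_sub, Complex.sub_re]
    have h4 := (Complex.re_le_norm _).trans h3
    linarith
  have hl1 : Tendsto (fun n => -((∑ i, ∑ j, ‖(f i).gnsMap (star ((star W * W) i j))‖) * δ n))
      atTop (𝓝 0) := by
    simpa using (hδ.const_mul _).neg
  have hl2 : Tendsto (fun n => (∑ i, ∑ j, f i ((star W * W) i j * c i j n)).re) atTop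
      (𝓝 (∑ i, ∑ j, centralKernel (f i) (f j) ((star W * W) i j)).re) :=
    (Complex.continuous_re.tendsto _).comp <| tendsto_finsetSum _ fun i _ =>
      tendsto_finsetSum _ fun j _ => tendsto_centralKernel (hlim i j) _
  exact le_of_tendsto_of_tendsto' hl1 hl2 hmain

/-- The centralizer kernel is positive definite. -/
lemma sum_centralKernel_nonneg (f : ι → M →ₚ[ℂ] ℂ) (x : ι → M) :
    0 ≤ (∑ i, ∑ j, centralKernel (f i) (f j) (star (x i) * x j)).re := by
  obtain ⟨W, hW⟩ := exists_star_mul_self_apply x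
  simpa only [hW] using sum_centralKernel_star_mul_self_nonneg f W

end PositiveLinearMap

/-! ### Multipliers -/

section Multiplier

variable {A : Type*} [NonUnitalCStarAlgebra A]

lemma eq_of_forall_mul_left_eq {a b : A} (h : ∀ y, y * a = y * b) : a = b := by
  apply star_injective
  refine eq_of_forall_mul_right_eq fun y => ?_
  rw [← star_star y, ← star_mul, ← star_mul, h]

lemma multiplier_fst_mul (m : 𝓜(ℂ, A)) (a b : A) : m.fst (a * b) = m.fst a * b :=
  eq_of_forall_mul_left_eq fun y => by
    rw [← m.central, ← mul_assoc, ← mul_assoc, m.central]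

lemma multiplier_ext_fst {m n : 𝓜(ℂ, A)} (h : ∀ a, m.fst a = n.fst a) : m = n := by
  refine DoubleCentralizer.ext ℂ A _ _ (Prod.ext (ContinuousLinearMap.ext h)
    (ContinuousLinearMap.ext fun a => eq_of_forall_mul_right_eq fun y => ?_))
  rw [m.central, n.central, h]

lemma multiplier_ext_snd {m n : 𝓜(ℂ, A)} (h : ∀ a, m.snd a = n.snd a) : m = n := by
  refine multiplier_ext_fst fun a => eq_of_forall_mul_left_eq fun y => ?_
  rw [← m.central, ← n.central, h]

lemma multiplier_coe_mul (a b : A) : ((a * b : A) : 𝓜(ℂ, A)) = (a : 𝓜(ℂ, A)) * b :=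
  map_mul (DoubleCentralizer.coeHom (𝕜 := ℂ) (A := A)) a b

lemma multiplier_coe_star (a : A) : ((star a : A) : 𝓜(ℂ, A)) = star (a : 𝓜(ℂ, A)) :=
  map_star (DoubleCentralizer.coeHom (𝕜 := ℂ) (A := A)) a

lemma multiplier_mul_coe (m : 𝓜(ℂ, A)) (a : A) : m * (a : 𝓜(ℂ, A)) = (m.fst a : A) :=
  multiplier_ext_fst fun b => by simp [multiplier_fst_mul]

lemma multiplier_coe_mul_left (m : 𝓜(ℂ, A)) (a : A) : (a : 𝓜(ℂ, A)) * m = (m.snd a : A) :=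
  multiplier_ext_snd fun b => by simp [multiplier_snd_mul]

lemma multiplier_coe_injective : Function.Injective (fun a : A => (a : 𝓜(ℂ, A))) := fun a b h =>
  eq_of_forall_mul_right_eq fun y => by
    simpa using congrArg (fun m : 𝓜(ℂ, A) => m.fst y) h

end Multiplier

/-! ### The kernel on the semigroup. -/

namespace TransferSystem

variable {A : Type u} [NonUnitalCStarAlgebra A] [PartialOrder A] [StarOrderedRing A]
  {S : Type v} [AddCommMonoid S] (D : TransferSystem A S)

lemma αBar_coe (s : S) (a : A) : D.αBar s (a : 𝓜(ℂ, A)) = (D.α s a : A) :=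
  (D.isMultiplierExtension_αBar s).map_coe a

lemma αBar_snd_alpha (s : S) (m : 𝓜(ℂ, A)) (x : A) :
    (D.αBar s m).snd (D.α s x) = D.α s (m.snd x) :=
  multiplier_coe_injective (by
    simp only [← multiplier_coe_mul_left, ← αBar_coe, ← map_mul])

lemma αBar_fst_alpha (s : S) (m : 𝓜(ℂ, A)) (x : A) :
    (D.αBar s m).fst (D.α s x) = D.α s (m.fst x) :=
  multiplier_coe_injective (by
    simp only [← multiplier_mul_coe, ← αBar_coe, ← map_mul])

/-- Multiplying on the right by `z` and moving it inside `L_s` as `α_s(z)` reduces this to the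
action of the extended endomorphism on `α_s(A)`. For `m = 1`, the corner projection is invisible to
`L_s`. -/
lemma L_αBar_snd (s : S) (m : 𝓜(ℂ, A)) (y : A) :
    D.L s ((D.αBar s m).snd y) = m.snd (D.L s y) :=
  eq_of_forall_mul_right_eq fun z => by
    rw [← L_mul_alpha, DoubleCentralizer.central, αBar_fst_alpha, L_mul_alpha,
      DoubleCentralizer.central]

/-- The functionals `m ↦ f (L_s (α_s(a)^* m α_s(a)))` on the multiplier algebra. -/
def multiplierFunctional [PartialOrder 𝓜(ℂ, A)] [StarOrderedRing 𝓜(ℂ, A)] (f : A →ₚ[ℂ] ℂ) (a : A)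
    (s : S) : 𝓜(ℂ, A) →ₚ[ℂ] ℂ :=
  PositiveLinearMap.mk₀
    { toFun m := f (D.L s (star (D.α s a) * m.fst (D.α s a)))
      map_add' m n := by
        rw [DoubleCentralizer.add_fst, add_apply, mul_add, map_add, map_add]
      map_smul' c m := by
        rw [DoubleCentralizer.smul_fst, smul_apply, mul_smul_comm,
          map_smul, map_smul, RingHom.id_apply] }
    fun m hm => by
      obtain ⟨b, rfl⟩ := CStarAlgebra.nonneg_iff_eq_star_mul_self.1 hm
      refine f.map_nonneg (D.L_nonneg s _ ?_)
      have : star (D.α s a) * (star b * b).fst (D.α s a) =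
          star (b.fst (D.α s a)) * b.fst (D.α s a) := by
        rw [← (star b * b).central, DoubleCentralizer.mul_snd]
        change b.snd ((star b).snd _) * _ = _
        rw [b.central, DoubleCentralizer.star_snd, star_star]
      rw [this]
      exact star_mul_self_nonneg _

lemma multiplierFunctional_apply [PartialOrder 𝓜(ℂ, A)] [StarOrderedRing 𝓜(ℂ, A)]
    (f : A →ₚ[ℂ] ℂ) (a : A) (s : S) (m : 𝓜(ℂ, A)) :
    D.multiplierFunctional f a s m = f (D.L s (star (D.α s a) * m.fst (D.α s a))) := rfl

/-- A positive definite kernel on `S` with values in functionals on the multiplier algebra,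
compatible with the transfer operators, and with a prescribed vacuum functional. -/
lemma exists_kernel (f : A →ₚ[ℂ] ℂ) (a : A) : ∃ K : S → S → 𝓜(ℂ, A) →ₗ[ℂ] ℂ,
    (∀ s t m, star (K s t m) = K t s (star m)) ∧
    (∀ (ι : Type v) [Fintype ι] (σ : ι → S) (x : ι → 𝓜(ℂ, A)),
      0 ≤ (∑ i, ∑ j, K (σ i) (σ j) (star (x i) * x j)).re) ∧
    (∀ r s t (b : A), K (r + s) (r + t) (b : 𝓜(ℂ, A)) = K s t (D.L r b : A)) ∧
    ∀ b : A, K 0 0 (b : 𝓜(ℂ, A)) = f (star a * b * a) := by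
  let : PartialOrder 𝓜(ℂ, A) := CStarAlgebra.spectralOrder _
  have : StarOrderedRing 𝓜(ℂ, A) := CStarAlgebra.spectralOrderedRing _
  let φ := D.multiplierFunctional f a
  refine ⟨fun s t => PositiveLinearMap.centralKernel (φ s) (φ t),
    fun s t m => PositiveLinearMap.star_centralKernel _ _ _, fun ι _ σ x => ?_,
    fun r s t b => ?_, fun b => ?_⟩
  · classical
    exact PositiveLinearMap.sum_centralKernel_nonneg (fun i => φ (σ i)) x
  · obtain ⟨Lbar, h1, h2⟩ := D.transfer r
    -- With `y = α_s(a)`, this is `L_r(α_r(y)^* m α_r(y)) = y^* Lbar(m) y` under `L_s`. It exhibits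
    -- the functionals at `r + s` and `r + t` as transfers of those at `s` and `t`.
    have hφ : ∀ s m, φ (r + s) m = φ s (Lbar m) := fun s m => by
      simp only [φ, multiplierFunctional_apply]
      rw [add_comm r s, D.L_add, add_comm s r, D.α_add]
      set y := D.α s a
      congr 2
      rw [← m.central, ← map_star, L_mul_alpha, h2, DoubleCentralizer.central]
    rw [PositiveLinearMap.centralKernel_comp (L := (Lbar : 𝓜(ℂ, A) →ₗ[ℂ] 𝓜(ℂ, A)))
      (α := D.αBar r) (hφ s) (hφ t)]
    · exact congrArg _ (h1 b)
    · refine fun m n => multiplier_ext_snd fun x => ?_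
      change (Lbar _).snd x = (Lbar n).snd (m.snd x)
      rw [← h2, ← h2, ← αBar_snd_alpha]
      rfl
    · refine fun m n => multiplier_ext_snd fun x => ?_
      change (Lbar _).snd x = m.snd ((Lbar n).snd x)
      rw [← h2, ← h2, ← L_αBar_snd]
      rfl
  · change PositiveLinearMap.centralKernel (φ 0) (φ 0) _ = _
    rw [PositiveLinearMap.centralKernel_self]
    simp only [φ, multiplierFunctional_apply, D.L_zero, D.α_zero]
    simp [mul_assoc]

end TransferSystem

/-! ### Hilbert spaces from positive definite kernels -/

/-- A positive semidefinite sesquilinear form comes from a map into a Hilbert space. -/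
lemma exists_hilbertSpace (E : Type w) [AddCommGroup E] [Module ℂ E]
    (c : PreInnerProductSpace.Core ℂ E) :
    ∃ (H : Type w) (_ : NormedAddCommGroup H) (_ : InnerProductSpace ℂ H) (_ : CompleteSpace H)
      (j : E →ₗ[ℂ] H), DenseRange j ∧ ∀ x y, ⟪j x, j y⟫_ℂ = c.inner x y := by
  let : SeminormedAddCommGroup E := InnerProductSpace.Core.toSeminormedAddCommGroup (c := c)
  let : InnerProductSpace ℂ E := InnerProductSpace.ofCore c
  refine ⟨UniformSpace.Completion E, inferInstance, inferInstance, inferInstance,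
    (UniformSpace.Completion.toComplL : E →L[ℂ] UniformSpace.Completion E).toLinearMap,
    UniformSpace.Completion.denseRange_coe, fun x y => UniformSpace.Completion.inner_coe x y⟩

section Kernel

variable {S : Type v} {A : Type u} [NonUnitalRing A] [StarRing A] [Module ℂ A]

/-- Positivity of the form at a finitely supported function is the hypothesis for the family indexed
by its support, which is why index types in `Type v` suffice. -/
lemma exists_hilbertSpace_of_kernel [StarModule ℂ A] [IsScalarTower ℂ A A] [SMulCommClass ℂ A A]
    (K : S → S → A →ₗ[ℂ] ℂ) (hs : ∀ s t a, star (K s t a) = K t s (star a))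
    (hp : ∀ (ι : Type v) [Fintype ι] (σ : ι → S) (x : ι → A),
      0 ≤ (∑ i, ∑ j, K (σ i) (σ j) (star (x i) * x j)).re) :
    ∃ (H : Type (max u v)) (_ : NormedAddCommGroup H) (_ : InnerProductSpace ℂ H)
      (_ : CompleteSpace H) (j : S → A →ₗ[ℂ] H), DenseRange (Finsupp.lsum ℂ j) ∧
      ∀ s t x y, ⟪j s x, j t y⟫_ℂ = K s t (star x * y) := by
  let c : PreInnerProductSpace.Core ℂ (S →₀ A) :=
    { inner F G := F.sum fun s x => G.sum fun t y => K s t (star x * y)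
      conj_inner_symm F G := by
        rw [Finsupp.sum_comm, ← Complex.star_def]
        simp only [Finsupp.sum, star_sum, hs, star_mul, star_star]
      re_inner_nonneg F := by
        have := hp F.support (fun s => s) (fun s => F s)
        simp only [Finset.sum_coe_sort F.support (fun s => ∑ t : F.support,
          K s t (star (F s) * F t))] at this
        refine this.trans_eq (congrArg _ (Finset.sum_congr rfl fun s _ => ?_))
        rw [Finset.sum_coe_sort F.support (fun t => K s t (star (F s) * F t))]
        rfl
      add_left F G E := by
        rw [Finsupp.sum_add_index']
        · simp
        · intro s x y
          simp [Finsupp.sum, add_mul, Finset.sum_add_distrib]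
      smul_left F G r := by
        rw [Finsupp.sum_smul_index' (by simp)]
        simp [Finsupp.sum, Finset.mul_sum, smul_mul_assoc] }
  obtain ⟨H, i1, i2, i3, J, hJ, hin⟩ := exists_hilbertSpace (S →₀ A) c
  refine ⟨H, i1, i2, i3, fun s => J ∘ₗ Finsupp.lsingle s, ?_, fun s t x y => ?_⟩
  · have : Finsupp.lsum ℂ (fun s => J ∘ₗ (Finsupp.lsingle s : A →ₗ[ℂ] S →₀ A)) = J := by
      ext; simp
    rwa [this]
  · rw [LinearMap.comp_apply, LinearMap.comp_apply, hin]
    change Finsupp.sum (Finsupp.single s x) (fun s x => Finsupp.sum (Finsupp.single t y)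
      fun t y => K s t (star x * y)) = _
    simp

end Kernel

section Operators

variable {S : Type v} {A : Type u} [AddCommGroup A] [Module ℂ A] {H : Type*}
  [NormedAddCommGroup H] [InnerProductSpace ℂ H]

lemma lsum_eq_sum_coe (g : S → A →ₗ[ℂ] H)
    (F : S →₀ A) : Finsupp.lsum ℂ g F = ∑ s : F.support, g s (F s) := by
  rw [Finsupp.lsum_apply, Finsupp.sum, ← Finset.sum_coe_sort]

lemma clm_ext_of_denseRange_lsum {j : S → A →ₗ[ℂ] H} (hj : DenseRange (Finsupp.lsum ℂ j))
    {F : Type*} [NormedAddCommGroup F] [NormedSpace ℂ F] {T T' : H →L[ℂ] F}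
    (h : ∀ s x, T (j s x) = T' (j s x)) : T = T' := by
  have h1 : T.toLinearMap ∘ₗ Finsupp.lsum ℂ j = T'.toLinearMap ∘ₗ Finsupp.lsum ℂ j :=
    Finsupp.lhom_ext fun s x => by simpa using h s x
  refine ContinuousLinearMap.ext fun x => ?_
  exact congrFun (hj.equalizer T.continuous T'.continuous
    (funext fun y => congrArg (fun f : (S →₀ A) →ₗ[ℂ] F => f y) h1)) x

lemma clm_ext_inner_of_denseRange_lsum {j : S → A →ₗ[ℂ] H} (hj : DenseRange (Finsupp.lsum ℂ j))
    {T T' : H →L[ℂ] H} (h : ∀ s x t y, ⟪j s x, T (j t y)⟫_ℂ = ⟪j s x, T' (j t y)⟫_ℂ) : T = T' := by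
  refine clm_ext_of_denseRange_lsum hj fun t y => ext_inner_left ℂ fun v => ?_
  have : ((innerSL ℂ) (T (j t y)) : H →L[ℂ] ℂ) = (innerSL ℂ) (T' (j t y)) :=
    clm_ext_of_denseRange_lsum hj fun s x => by
      rw [innerSL_apply_apply, innerSL_apply_apply, ← inner_conj_symm, h, inner_conj_symm]
  have h2 := congrArg (fun f : H →L[ℂ] ℂ => star (f v)) this
  simpa using h2

/-- The form inequality both makes the operator well defined on the dense range of `j` and bounds it
there. -/
lemma exists_clm_of_lsum [CompleteSpace H] {j : S → A →ₗ[ℂ] H}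
    (hj : DenseRange (Finsupp.lsum ℂ j))
    (g : S → A →ₗ[ℂ] H) (C : ℝ) (hC : ∀ F : S →₀ A,
      (∑ s : F.support, ∑ t : F.support, ⟪g s (F s), g t (F t)⟫_ℂ).re ≤
      C * (∑ s : F.support, ∑ t : F.support, ⟪j s (F s), j t (F t)⟫_ℂ).re) :
    ∃ T : H →L[ℂ] H, ∀ s x, T (j s x) = g s x := by
  have hn : ∀ (g : S → A →ₗ[ℂ] H) (F : S →₀ A), ‖Finsupp.lsum ℂ g F‖ ^ 2 =
      (∑ s : F.support, ∑ t : F.support, ⟪g s (F s), g t (F t)⟫_ℂ).re := fun g F => by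
    rw [← inner_self_eq_norm_sq (𝕜 := ℂ), lsum_eq_sum_coe, sum_inner]
    simp only [inner_sum]
    rfl
  have hb : ∀ F, ‖Finsupp.lsum ℂ g F‖ ≤ √|C| * ‖Finsupp.lsum ℂ j F‖ := fun F => by
    refine le_of_sq_le_sq ?_ (by positivity)
    rw [mul_pow, Real.sq_sqrt (abs_nonneg _), hn]
    refine (hC F).trans ?_
    rw [hn, ← hn]
    gcongr
    exact le_abs_self C
  refine ⟨(Finsupp.lsum ℂ g).extendOfNorm (Finsupp.lsum ℂ j), fun s x => ?_⟩
  have := LinearMap.extendOfNorm_eq hj ⟨_, hb⟩ (Finsupp.single s x)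
  simpa using this

end Operators

/-! ### Covariant pairs separating the points of `A`. -/

namespace TransferSystem

variable {A : Type u} [NonUnitalCStarAlgebra A] [PartialOrder A] [StarOrderedRing A]
  {S : Type v} [AddCommMonoid S] (D : TransferSystem A S)

/-- The multiplier is the extended `L_s` at `1`. It supplies the bound for the operator `V_s`. -/
lemma exists_L_alpha_eq_fst (s : S) : ∃ d : 𝓜(ℂ, A), ∀ x, D.L s (D.α s x) = d.fst x := by
  obtain ⟨Lbar, h1, h2⟩ := D.transfer s
  refine ⟨Lbar 1, fun x => eq_of_forall_mul_left_eq fun y => ?_⟩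
  rw [← DoubleCentralizer.central, ← h2, ← L_alpha_mul, ← map_mul, map_mul, L_mul_alpha]
  rfl

/-- Here `b^* b = ‖m‖² - m^* m`. Left multiplication by `m` is then bounded on any space given by a
positive definite kernel, since the defect is again a positive form. -/
lemma exists_star_mul_self_eq (m : 𝓜(ℂ, A)) : ∃ b : 𝓜(ℂ, A), ∀ x y : A,
    star (m.fst x) * m.fst y + star (b.fst x) * b.fst y = ((‖m‖ ^ 2 : ℝ) : ℂ) • (star x * y) := by
  let : PartialOrder 𝓜(ℂ, A) := CStarAlgebra.spectralOrder _
  have : StarOrderedRing 𝓜(ℂ, A) := CStarAlgebra.spectralOrderedRing _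
  have h : star m * m ≤ algebraMap ℝ _ (‖m‖ ^ 2) := by
    rw [sq, ← CStarRing.norm_star_mul_self]
    exact IsSelfAdjoint.le_algebraMap_norm_self (.star_mul_self m)
  obtain ⟨b, hb⟩ := CStarAlgebra.nonneg_iff_eq_star_mul_self.1 (sub_nonneg.2 h)
  refine ⟨b, fun x y => ?_⟩
  have key : ∀ n : 𝓜(ℂ, A), star (n.fst x) * n.fst y = star x * (star n * n).fst y := fun n => by
    rw [← (star n * n).central, DoubleCentralizer.mul_snd]
    change _ = n.snd ((star n).snd _) * _
    rw [n.central, DoubleCentralizer.star_snd, star_star]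
  rw [key, key, ← hb, DoubleCentralizer.sub_fst, ← mul_add, sub_apply, add_sub_cancel,
    Algebra.algebraMap_eq_smul_one, DoubleCentralizer.smul_fst, smul_apply,
    ← Complex.coe_smul, mul_smul_comm]
  rfl

/-- Representations satisfying the covariance relations, on a Hilbert space, separate the points
of `A`. -/
lemma exists_covariant_ne_zero {a : A} (ha : a ≠ 0) :
    ∃ (H : Type (max u v)) (_ : NormedAddCommGroup H) (_ : InnerProductSpace ℂ H)
      (_ : CompleteSpace H) (π : A →⋆ₙₐ[ℂ] (H →L[ℂ] H)) (V : S → H →L[ℂ] H),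
      V 0 = 1 ∧ (∀ s t, V (s + t) = V s * V t) ∧ (∀ s a, V s * π a = π (D.α s a) * V s) ∧
      (∀ s a, star (V s) * π a * V s = π (D.L s a)) ∧ π a ≠ 0 := by
  -- The test vector will be `j_0(a^*)`, and `‖π(a) j_0(a^*)‖² = f(x^* x)` with `x = a a^* a`; so
  -- `f` is chosen not to vanish at `x^* x`.
  have hx0 : a * star a * a ≠ 0 := fun h => ha <| by
    rw [← CStarRing.mul_star_self_eq_zero_iff,
      ← CStarRing.star_mul_self_eq_zero_iff (a * star a), star_mul, star_star, ← mul_assoc, h,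
      zero_mul]
  obtain ⟨f, hf⟩ := exists_positiveLinearMap_ne_zero (star_mul_self_nonneg (a * star a * a))
    ((CStarRing.star_mul_self_eq_zero_iff _).not.2 hx0)
  obtain ⟨K, hKs, hKp, hKL, hK0⟩ := D.exists_kernel f a
  let K' : S → S → A →ₗ[ℂ] ℂ := fun s t => K s t ∘ₗ
    (DoubleCentralizer.coeHom (𝕜 := ℂ) (A := A) : A →ₗ[ℂ] 𝓜(ℂ, A))
  have hK' : ∀ s t x, K' s t x = K s t (x : 𝓜(ℂ, A)) := fun _ _ _ => rfl
  obtain ⟨H, i1, i2, i3, j, hj, hin⟩ := exists_hilbertSpace_of_kernel K'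
    (fun s t x => by rw [hK', hK', hKs, multiplier_coe_star])
    (fun ι _ σ x => by
      simpa only [hK', multiplier_coe_mul, multiplier_coe_star] using
        hKp ι σ fun i => (x i : 𝓜(ℂ, A)))
  have hleft : ∀ m : 𝓜(ℂ, A), ∃ T : H →L[ℂ] H, ∀ s x, T (j s x) = j s (m.fst x) := fun m => by
    obtain ⟨b, hb⟩ := exists_star_mul_self_eq m
    refine exists_clm_of_lsum hj (fun s => j s ∘ₗ (m.fst : A →ₗ[ℂ] A)) (‖m‖ ^ 2) fun F => ?_
    have h1 : ∀ s t x y, ⟪j s (m.fst x), j t (m.fst y)⟫_ℂ =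
        ((‖m‖ ^ 2 : ℝ) : ℂ) * ⟪j s x, j t y⟫_ℂ - ⟪j s (b.fst x), j t (b.fst y)⟫_ℂ :=
      fun s t x y => by
        rw [hin, hin, hin, eq_sub_iff_add_eq, ← map_add, hb, map_smul, smul_eq_mul]
    have h2 : 0 ≤ (∑ s : F.support, ∑ t : F.support,
        ⟪j s (b.fst (F s)), j t (b.fst (F t))⟫_ℂ).re := by
      simp only [← inner_sum, ← sum_inner]
      exact inner_self_nonneg (𝕜 := ℂ)
    simp only [LinearMap.comp_apply, ContinuousLinearMap.coe_coe, h1, Finset.sum_sub_distrib,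
      Complex.sub_re, ← Finset.mul_sum, Complex.re_ofReal_mul]
    linarith
  choose T hT using hleft
  have hTstar : ∀ a : A, T (star a : A) = star (T a) := fun a => by
    rw [ContinuousLinearMap.star_eq_adjoint]
    refine clm_ext_inner_of_denseRange_lsum hj fun s x t y => ?_
    rw [ContinuousLinearMap.adjoint_inner_right, hT, hT, hin, hin]
    simp [mul_assoc]
  let π : A →⋆ₙₐ[ℂ] (H →L[ℂ] H) :=
    { toFun a := T a
      map_smul' c x := clm_ext_of_denseRange_lsum hj fun s y => by
        simp [hT]
      map_zero' := clm_ext_of_denseRange_lsum hj fun s y => by simp [hT]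
      map_add' x y := clm_ext_of_denseRange_lsum hj fun s z => by simp [hT]
      map_mul' x y := clm_ext_of_denseRange_lsum hj fun s z => by simp [hT, mul_assoc]
      map_star' := hTstar }
  have hπ : ∀ a s x, π a (j s x) = j s (a * x) := fun a s x => hT a s x
  have hVin : ∀ r s t x y, ⟪j (r + s) (D.α r x), j (r + t) (D.α r y)⟫_ℂ =
      ⟪j s x, j t (D.L r (D.α r y))⟫_ℂ := fun r s t x y => by
    rw [hin, hin, hK', hK', hKL, ← map_star, L_alpha_mul]
  have hV : ∀ r, ∃ V : H →L[ℂ] H, ∀ s x, V (j s x) = j (r + s) (D.α r x) := fun r => by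
    obtain ⟨d, hd⟩ := D.exists_L_alpha_eq_fst r
    -- The transfer property of the kernel gives `‖V_r ξ‖² = ⟪ξ, T_d ξ⟫`, where `T_d` is the action
    -- of the multiplier `d` with `L_r(α_r(x)) = d x`.
    refine exists_clm_of_lsum hj (fun s => j (r + s) ∘ₗ (D.α r : A →ₗ[ℂ] A)) ‖T d‖ fun F => ?_
    change (∑ s : F.support, ∑ t : F.support,
      ⟪j (r + s) (D.α r (F s)), j (r + t) (D.α r (F t))⟫_ℂ).re ≤ _
    simp only [hVin, hd, ← hT, ← inner_sum, ← sum_inner, ← map_sum]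
    set ξ := ∑ s : F.support, j s (F s)
    have h3 : (⟪ξ, ξ⟫_ℂ).re = ‖ξ‖ ^ 2 := inner_self_eq_norm_sq (𝕜 := ℂ) ξ
    rw [h3]
    calc _ ≤ ‖⟪ξ, T d ξ⟫_ℂ‖ := Complex.re_le_norm _
      _ ≤ ‖ξ‖ * (‖T d‖ * ‖ξ‖) := (norm_inner_le_norm _ _).trans (by
        gcongr; exact ContinuousLinearMap.le_opNorm _ _)
      _ = _ := by ring
  choose V hV using hV
  refine ⟨H, i1, i2, i3, π, V, ?_, ?_, ?_, ?_, ?_⟩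
  · exact clm_ext_of_denseRange_lsum hj fun s x => by simp [hV, D.α_zero]
  · exact fun r t => clm_ext_of_denseRange_lsum hj fun s x => by
      simp [hV, D.α_add, add_assoc]
  · exact fun r a => clm_ext_of_denseRange_lsum hj fun s x => by simp [hV, hπ]
  · intro r a
    refine clm_ext_inner_of_denseRange_lsum hj fun s x t y => ?_
    simp only [ContinuousLinearMap.star_eq_adjoint, ContinuousLinearMap.mul_def,
      ContinuousLinearMap.comp_apply, hV, hπ, ContinuousLinearMap.adjoint_inner_right]
    rw [hin, hin, hK', hK', hKL, ← map_star, ← mul_assoc, mul_assoc, L_alpha_mul, L_mul_alpha]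
  · intro h
    apply hf
    have h1 : ⟪π a (j 0 (star a)), π a (j 0 (star a))⟫_ℂ =
        f (star (a * star a * a) * (a * star a * a)) := by
      rw [hπ, hin, hK', hK0]
      simp only [star_mul, mul_assoc]
    rw [← h1, h]
    simp

end TransferSystem

/-! ### Bounded nets of operators, strict limits, extensions to multiplier algebras -/

section Nets

/-- A bounded net of operators which converges pointwise on a total set converges pointwise. -/
lemma exists_clm_tendsto {E F ι : Type*} [NormedAddCommGroup E] [NormedSpace ℂ E]
    [NormedAddCommGroup F] [NormedSpace ℂ F] [CompleteSpace F] {f : ι → E →L[ℂ] F} {l : Filter ι}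
    [l.NeBot] {C : ℝ} (hC : ∀ᶠ i in l, ‖f i‖ ≤ C) {s : Set E}
    (hs : Dense (Submodule.span ℂ s : Set E))
    (hf : ∀ x ∈ s, ∃ y, Tendsto (fun i => f i x) l (𝓝 y)) :
    ∃ g : E →L[ℂ] F, ∀ x, Tendsto (fun i => f i x) l (𝓝 (g x)) := by
  have hC0 : 0 ≤ C := let ⟨i, hi⟩ := hC.exists; (norm_nonneg _).trans hi
  have hspan : ∀ x ∈ Submodule.span ℂ s, ∃ y, Tendsto (fun i => f i x) l (𝓝 y) := fun x hx => by
    induction hx using Submodule.span_induction with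
    | mem x hx => exact hf x hx
    | zero => exact ⟨0, by simp⟩
    | add x y _ _ hx hy =>
      obtain ⟨a, ha⟩ := hx
      obtain ⟨b, hb⟩ := hy
      exact ⟨a + b, by simpa using ha.add hb⟩
    | smul c x _ hx =>
      obtain ⟨a, ha⟩ := hx
      exact ⟨c • a, by simpa using ha.const_smul c⟩
  have hall : ∀ x, ∃ y, Tendsto (fun i => f i x) l (𝓝 y) := fun x => by
    rw [← cauchy_map_iff_exists_tendsto, cauchy_map_iff',
      Metric.uniformity_basis_dist.tendsto_right_iff]
    intro ε hε
    -- Replacing `x` by `x'` costs less than `ε / 4` uniformly along the net, and convergence at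
    -- `x'` costs another `ε / 4`.
    obtain ⟨x', hx', hd⟩ := Metric.dense_iff.1 hs x (ε / (4 * (C + 1))) (by positivity)
    obtain ⟨y, hy⟩ := hspan x' hd
    rw [Metric.mem_ball, dist_comm, dist_eq_norm, lt_div_iff₀ (by positivity)] at hx'
    have hnear : ∀ᶠ i in l, dist (f i x) y < ε / 2 := by
      filter_upwards [hC, Metric.tendsto_nhds.1 hy (ε / 4) (by positivity)] with i hi hiy
      have h1 : dist (f i x) (f i x') ≤ C * ‖x - x'‖ := by
        rw [dist_eq_norm, ← map_sub]
        exact (f i).le_of_opNorm_le hi _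
      nlinarith [dist_triangle (f i x) (f i x') y, norm_nonneg (x - x')]
    filter_upwards [hnear.prod_mk hnear] with p hp
    exact (dist_triangle_right _ _ y).trans_lt (by linarith [hp.1, hp.2])
  choose g hg using hall
  let G : E →ₗ[ℂ] F :=
    { toFun := g
      map_add' x y := tendsto_nhds_unique (hg (x + y)) (by simpa using (hg x).add (hg y))
      map_smul' c x := tendsto_nhds_unique (hg (c • x)) (by simpa using (hg x).const_smul c) }
  refine ⟨G.mkContinuous C fun x => le_of_tendsto (hg x).norm ?_, hg⟩
  filter_upwards [hC] with i hi using (f i).le_of_opNorm_le hi _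

variable {B : Type*} [NonUnitalCStarAlgebra B]

lemma exists_isBoundedApproximateUnit (B : Type*) [NonUnitalCStarAlgebra B] :
    ∃ l : Filter B, IsBoundedApproximateUnit l := by
  let _ := CStarAlgebra.spectralOrder B
  have _ := CStarAlgebra.spectralOrderedRing B
  exact ⟨_, (CStarAlgebra.increasingApproximateUnit B).toIsApproximateUnit,
    1, (CStarAlgebra.increasingApproximateUnit B).eventually_norm⟩

section Rep

variable {H : Type*} [NormedAddCommGroup H] [InnerProductSpace ℂ H] [CompleteSpace H]

/-- The extension of a non-degenerate representation to the multiplier algebra. -/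
lemma IsNondegenerateRep.exists_extension {σ : B →⋆ₙₐ[ℂ] (H →L[ℂ] H)}
    (hσ : IsNondegenerateRep σ) :
    ∃ σ' : 𝓜(ℂ, B) →⋆ₐ[ℂ] (H →L[ℂ] H), ∀ b : B, σ' (b : 𝓜(ℂ, B)) = σ b := by
  obtain ⟨l, hl, C, hC⟩ := exists_isBoundedApproximateUnit B
  have := hl.neBot
  have hcont : Continuous σ := AddMonoidHomClass.continuous_of_bound σ 1 fun x => by
    simpa using NonUnitalStarAlgHom.norm_apply_le σ x
  have hadj : ∀ x y k k', ⟪σ x k, σ y k'⟫_ℂ = ⟪k, σ (star x * y) k'⟫_ℂ := fun x y k k' => by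
    rw [map_mul, map_star, ContinuousLinearMap.star_eq_adjoint, ContinuousLinearMap.mul_def,
      ContinuousLinearMap.comp_apply, ContinuousLinearMap.adjoint_inner_right]
  -- The operator is the pointwise limit of the bounded net `σ(m u)`, so well-definedness on the
  -- span of the vectors `σ(b) k` need not be checked by hand.
  have hT : ∀ m : 𝓜(ℂ, B), ∃ T : H →L[ℂ] H, ∀ b k, T (σ b k) = σ (m.fst b) k := fun m => by
    have hlim : ∀ b k, Tendsto (fun u => σ (m.fst u) (σ b k)) l (𝓝 (σ (m.fst b) k)) :=
      fun b k => by
        have h1 : Continuous fun x : B => σ (m.fst x) k :=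
          (hcont.comp m.fst.continuous).clm_apply continuous_const
        refine ((h1.tendsto b).comp (hl.tendsto_mul_right b)).congr fun u => ?_
        simp [multiplier_fst_mul]
    obtain ⟨T, hT⟩ := exists_clm_tendsto (f := fun u => σ (m.fst u)) (C := ‖m.fst‖ * C)
      (hC.mono fun u hu => (NonUnitalStarAlgHom.norm_apply_le σ _).trans
        ((m.fst.le_opNorm u).trans (by gcongr))) hσ
      (by rintro _ ⟨b, k, rfl⟩; exact ⟨_, hlim b k⟩)
    exact ⟨T, fun b k => tendsto_nhds_unique (hT _) (hlim b k)⟩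
  choose T hT using hT
  have hext : ∀ {S T : H →L[ℂ] H}, (∀ b k, S (σ b k) = T (σ b k)) → S = T := fun h =>
    ContinuousLinearMap.ext_on hσ (by rintro _ ⟨b, k, rfl⟩; exact h b k)
  refine ⟨{ toFun := T, map_one' := ?_, map_mul' := ?_, map_zero' := ?_, map_add' := ?_,
            commutes' := ?_, map_star' := ?_ }, fun b => hext fun c k => ?_⟩
  · exact hext fun b k => by simp [hT]
  · exact fun m n => hext fun b k => by simp [hT]
  · exact hext fun b k => by simp [hT]
  · exact fun m n => hext fun b k => by simp [hT]
  · refine fun c => hext fun b k => ?_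
    rw [hT, Algebra.algebraMap_eq_smul_one, Algebra.algebraMap_eq_smul_one]
    simp
  · intro m
    refine ContinuousLinearMap.ext_on hσ ?_
    rintro _ ⟨b, k, rfl⟩
    rw [ContinuousLinearMap.star_eq_adjoint]
    refine hσ.eq_of_inner_left (𝕜 := ℂ) ?_
    intro x hx
    induction hx using Submodule.span_induction with
    | mem x hx =>
      obtain ⟨c, k', rfl⟩ := hx
      rw [ContinuousLinearMap.adjoint_inner_left, hT, hT]
      rw [hadj, hadj, DoubleCentralizer.star_fst, star_star, DoubleCentralizer.central]
    | zero => simp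
    | add x y _ _ hx hy => rw [inner_add_right, inner_add_right, hx, hy]
    | smul c x _ hx => rw [inner_smul_right, inner_smul_right, hx]
  · simp [hT]

end Rep

variable {A : Type*} [NonUnitalCStarAlgebra A] {φ : A →⋆ₙₐ[ℂ] B}

lemma IsNondegenerateHom.dense_right (hφ : IsNondegenerateHom φ) :
    Dense (Submodule.span ℂ {c : B | ∃ a b, c = b * φ a} : Set B) := by
  have h : Dense (star '' (Submodule.span ℂ {c : B | ∃ a b, c = φ a * b} : Set B)) :=
    (star_involutive.surjective.denseRange).dense_image continuous_star hφ
  refine h.mono ?_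
  rintro _ ⟨x, hx, rfl⟩
  induction hx using Submodule.span_induction with
  | mem x hx =>
    obtain ⟨a, b, rfl⟩ := hx
    exact Submodule.subset_span ⟨star a, star b, by simp [map_star]⟩
  | zero => simp
  | add x y _ _ hx hy => rw [star_add]; exact add_mem hx hy
  | smul c x _ hx => rw [star_smul]; exact Submodule.smul_mem _ _ hx

lemma IsNondegenerateHom.multiplier_ext (hφ : IsNondegenerateHom φ) {m n : 𝓜(ℂ, B)}
    (h : ∀ a, m.fst (φ a) = n.fst (φ a)) : m = n := by
  refine multiplier_ext_fst fun x => ?_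
  rw [ContinuousLinearMap.ext_on (f := m.fst) (g := n.fst) hφ]
  rintro _ ⟨a, b, rfl⟩
  rw [multiplier_fst_mul, multiplier_fst_mul, h]

/-- Boundedness spreads convergence from `φ(A)` to the closed spans of `φ(A) B` and `B φ(A)`, both
equal to `B`. The two limits form a double centralizer because `(x f_i) y = x (f_i y)` for every
`i`. -/
lemma IsNondegenerateHom.exists_strictTendsto (hφ : IsNondegenerateHom φ) {ι : Type*} {f : ι → B}
    {l : Filter ι} [l.NeBot] {C : ℝ} (hC : ∀ᶠ i in l, ‖f i‖ ≤ C)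
    (h1 : ∀ a, ∃ y, Tendsto (fun i => f i * φ a) l (𝓝 y))
    (h2 : ∀ a, ∃ y, Tendsto (fun i => φ a * f i) l (𝓝 y)) :
    ∃ m : 𝓜(ℂ, B), StrictTendsto (fun i => (f i : 𝓜(ℂ, B))) l m := by
  obtain ⟨p, hp⟩ := exists_clm_tendsto (f := fun i => ContinuousLinearMap.mul ℂ B (f i)) (l := l)
    (C := C) (by filter_upwards [hC] with i hi using
      (ContinuousLinearMap.opNorm_mul_apply_le ℂ B _).trans hi) hφ (by
      rintro _ ⟨a, b, rfl⟩
      obtain ⟨y, hy⟩ := h1 a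
      exact ⟨y * b, by simpa [mul_assoc] using hy.mul_const b⟩)
  obtain ⟨q, hq⟩ := exists_clm_tendsto (f := fun i => (ContinuousLinearMap.mul ℂ B).flip (f i))
    (l := l) (C := C) (by
      filter_upwards [hC] with i hi
      refine ContinuousLinearMap.opNorm_le_bound _ ((norm_nonneg _).trans hi) fun x => ?_
      rw [ContinuousLinearMap.flip_apply, ContinuousLinearMap.mul_apply', mul_comm C]
      exact (norm_mul_le _ _).trans (by gcongr)) hφ.dense_right (by
      rintro _ ⟨a, b, rfl⟩
      obtain ⟨y, hy⟩ := h2 a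
      exact ⟨b * y, by simpa [mul_assoc] using hy.const_mul b⟩)
  refine ⟨⟨(p, q), fun x y => tendsto_nhds_unique ((hq x).mul_const y)
    (((hp y).const_mul x).congr fun i => ?_)⟩, fun b => ⟨hp b, hq b⟩⟩
  simp [mul_assoc]

lemma IsNondegenerateHom.strictTendsto (hφ : IsNondegenerateHom φ) {ι : Type*} {f : ι → B}
    {l : Filter ι} [l.NeBot] {C : ℝ} (hC : ∀ᶠ i in l, ‖f i‖ ≤ C) {m : 𝓜(ℂ, B)}
    (h1 : ∀ a, Tendsto (fun i => f i * φ a) l (𝓝 (m.fst (φ a))))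
    (h2 : ∀ a, Tendsto (fun i => φ a * f i) l (𝓝 (m.snd (φ a)))) :
    StrictTendsto (fun i => (f i : 𝓜(ℂ, B))) l m := by
  obtain ⟨n, hn⟩ := hφ.exists_strictTendsto hC (fun a => ⟨_, h1 a⟩) (fun a => ⟨_, h2 a⟩)
  rwa [hφ.multiplier_ext fun a => tendsto_nhds_unique (h1 a) (hn (φ a)).1]

end Nets

/-! ### Universal `C*`-algebras -/

section Universal

open scoped ENNReal

/-- The evaluation at `ψ` of the (non-associative) `*`-polynomials in the variables `X`. -/
def starEval {X B : Type*} [NonUnitalCStarAlgebra B] (ψ : X → B) :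
    FreeNonUnitalNonAssocAlgebra ℂ (X ⊕ X) →ₙₐ[ℂ] B :=
  FreeNonUnitalNonAssocAlgebra.lift ℂ (Sum.elim ψ fun x => star (ψ x))

lemma starEval_comp {X B C : Type*} [NonUnitalCStarAlgebra B] [NonUnitalCStarAlgebra C]
    (ψ : X → B) (φ : B →⋆ₙₐ[ℂ] C) (e : FreeNonUnitalNonAssocAlgebra ℂ (X ⊕ X)) :
    φ (starEval ψ e) = starEval (fun x => φ (ψ x)) e := by
  have h : (φ : B →ₙₐ[ℂ] C).comp (starEval ψ) = starEval (fun x => φ (ψ x)) := by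
    apply FreeNonUnitalNonAssocAlgebra.hom_ext
    intro x
    cases x
    · simp [starEval]
      rfl
    · simp only [starEval, NonUnitalAlgHom.comp_apply, FreeNonUnitalNonAssocAlgebra.lift_of_apply]
      exact map_star φ _
  exact DFunLike.congr_fun h e

lemma adjoin_subset_range_starEval {X B : Type*} [NonUnitalCStarAlgebra B] (ψ : X → B) :
    (NonUnitalStarAlgebra.adjoin ℂ (Set.range ψ) : Set B) ⊆ Set.range (starEval ψ) := by
  have h : NonUnitalAlgebra.adjoin ℂ (Set.range ψ ∪ star (Set.range ψ)) ≤
      NonUnitalAlgHom.range (starEval ψ) := by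
    refine NonUnitalAlgebra.adjoin_le ?_
    rintro x (⟨y, rfl⟩ | ⟨y, hy⟩)
    · exact ⟨FreeNonUnitalNonAssocAlgebra.of ℂ (Sum.inl y),
        FreeNonUnitalNonAssocAlgebra.lift_of_apply _ _ _⟩
    · exact ⟨FreeNonUnitalNonAssocAlgebra.of ℂ (Sum.inr y),
        (FreeNonUnitalNonAssocAlgebra.lift_of_apply _ _ _).trans (by simp [hy])⟩
  exact fun x hx => h hx

/-- Extension of a map on generators to a `*`-homomorphism. -/
lemma exists_starHom_of_norm_starEval_le {X T B : Type*} [NonUnitalCStarAlgebra T]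
    [NonUnitalCStarAlgebra B] {ψ : X → T} {χ : X → B}
    (hψ : Dense (NonUnitalStarAlgebra.adjoin ℂ (Set.range ψ) : Set T))
    (h : ∀ e, ‖starEval χ e‖ ≤ ‖starEval ψ e‖) :
    ∃ φ : T →⋆ₙₐ[ℂ] B, ∀ x, φ (ψ x) = χ x := by
  have hd₀ : DenseRange (starEval ψ) := hψ.mono (adjoin_subset_range_starEval ψ)
  have hd : DenseRange (starEval ψ : FreeNonUnitalNonAssocAlgebra ℂ (X ⊕ X) →ₗ[ℂ] T) := hd₀
  let g : T →L[ℂ] B := LinearMap.extendOfNorm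
    (starEval χ : FreeNonUnitalNonAssocAlgebra ℂ (X ⊕ X) →ₗ[ℂ] B)
    (starEval ψ : FreeNonUnitalNonAssocAlgebra ℂ (X ⊕ X) →ₗ[ℂ] T)
  have hg : ∀ e, g (starEval ψ e) = starEval χ e := fun e =>
    LinearMap.extendOfNorm_eq hd ⟨1, fun x => by simpa using h x⟩ e
  have hgψ : ∀ x, g (ψ x) = χ x := fun x => by
    simpa [starEval] using hg (FreeNonUnitalNonAssocAlgebra.of ℂ (Sum.inl x))
  have hmul : ∀ x y, g (x * y) = g x * g y := fun x y => by
    refine hd.induction_on₂ (p := fun x y => g (x * y) = g x * g y)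
      (isClosed_eq (by fun_prop) (by fun_prop)) (fun a b => ?_) x y
    change g (starEval ψ a * starEval ψ b) = g (starEval ψ a) * g (starEval ψ b)
    rw [← map_mul, hg, hg, hg, map_mul]
  -- The free algebra carries no involution, so compatibility with adjoints is proved by induction
  -- on the generated `*`-algebra; the second copy of `X` handles adjoints of generators.
  have hstar : ∀ x, g (star x) = star (g x) := fun x => by
    refine hψ.induction (P := fun x => g (star x) = star (g x)) (fun x hx => ?_)
      (isClosed_eq (by fun_prop) (by fun_prop)) x
    induction hx using NonUnitalStarAlgebra.adjoin_induction with
    | mem x hx =>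
      obtain ⟨y, rfl⟩ := hx
      rw [hgψ]
      simpa [starEval] using hg (FreeNonUnitalNonAssocAlgebra.of ℂ (Sum.inr y))
    | add x y _ _ hx hy => simp [hx, hy]
    | zero => simp
    | mul x y _ _ hx hy => rw [star_mul, hmul, hmul, hx, hy, star_mul]
    | smul c x _ hx => simp [hx]
    | star x _ hx => rw [hx, star_star, star_star]
  exact ⟨{ g with
    map_zero' := map_zero g
    map_mul' := hmul
    map_star' := hstar }, hgψ⟩

/-- The coordinate projections of an `ℓ^∞`-product of `C*`-algebras. -/
def lpEval {ι : Type*} (B : ι → Type*) [∀ i, NonUnitalCStarAlgebra (B i)] (i : ι) :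
    lp B ∞ →⋆ₙₐ[ℂ] B i where
  toFun f := f i
  map_smul' c f := by simp
  map_zero' := by simp
  map_add' f g := by simp
  map_mul' f g := by simp [lp.infty_coeFn_mul]
  map_star' f := by simp

/-- Existence of universal `C*`-algebras for norm bounded relations which can be checked in a
jointly injective family of `*`-homomorphisms. -/
theorem exists_universal_cstarAlgebra {X : Type w}
    (P : ∀ (B : Type w) [NonUnitalCStarAlgebra B], (X → B) → Prop) (c : X → ℝ)
    (hc : ∀ (B : Type w) [NonUnitalCStarAlgebra B] (ψ : X → B), P B ψ → ∀ x, ‖ψ x‖ ≤ c x)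
    (hP : ∀ (T : Type w) [NonUnitalCStarAlgebra T] (ι : Type w) (B : ι → Type w)
      [∀ i, NonUnitalCStarAlgebra (B i)] (φ : ∀ i, T →⋆ₙₐ[ℂ] B i) (ψ : X → T),
      (∀ x y, (∀ i, φ i x = φ i y) → x = y) → (∀ i, P (B i) fun x => φ i (ψ x)) → P T ψ) :
    ∃ (T : Type w) (_ : NonUnitalCStarAlgebra T) (ψ : X → T), P T ψ ∧
      Dense (NonUnitalStarAlgebra.adjoin ℂ (Set.range ψ) : Set T) ∧
      ∀ (B : Type w) [NonUnitalCStarAlgebra B] (χ : X → B), P B χ →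
        ∃ φ : T →⋆ₙₐ[ℂ] B, ∀ x, φ (ψ x) = χ x := by
  -- All representations form a proper class, but the seminorms they induce on the free algebra form
  -- a type in the same universe. One representation per seminorm is enough, because the
  -- factorization only compares norms.
  let I := {q : FreeNonUnitalNonAssocAlgebra ℂ (X ⊕ X) → ℝ //
    ∃ (B : Type w) (_ : NonUnitalCStarAlgebra B) (χ : X → B), P B χ ∧ ∀ e, q e = ‖starEval χ e‖}
  choose B instB χ hχ hq using fun q : I => q.2
  let Ψ : X → lp B ∞ := fun x => ⟨fun q => χ q x, memℓp_infty ⟨c x, by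
    rintro _ ⟨q, rfl⟩
    exact hc _ _ (hχ q) x⟩⟩
  let T := (NonUnitalStarAlgebra.adjoin ℂ (Set.range Ψ)).topologicalClosure
  have hT : IsClosed (T : Set (lp B ∞)) :=
    NonUnitalStarSubalgebra.isClosed_topologicalClosure _
  let instT : NonUnitalCStarAlgebra T := NonUnitalStarSubalgebra.nonUnitalCStarAlgebra T
  let ψ : X → T := fun x => ⟨Ψ x, NonUnitalStarSubalgebra.le_topologicalClosure _
    (NonUnitalStarAlgebra.subset_adjoin ℂ _ ⟨x, rfl⟩)⟩
  let sub : T →⋆ₙₐ[ℂ] lp B ∞ := NonUnitalStarSubalgebraClass.subtype T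
  have hψ : Dense (NonUnitalStarAlgebra.adjoin ℂ (Set.range ψ) : Set T) := by
    have h : (NonUnitalStarAlgebra.adjoin ℂ (Set.range ψ)).map sub =
        NonUnitalStarAlgebra.adjoin ℂ (Set.range Ψ) := by
      rw [NonUnitalStarAlgHom.map_adjoin, ← Set.range_comp]
      rfl
    rw [Subtype.dense_iff]
    intro x hx
    have h' : ((↑) : T → lp B ∞) '' (NonUnitalStarAlgebra.adjoin ℂ (Set.range ψ) : Set T) =
        (NonUnitalStarAlgebra.adjoin ℂ (Set.range Ψ) : Set (lp B ∞)) := by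
      rw [← h]; rfl
    exact h'.symm ▸ hx
  refine ⟨T, instT, ψ, hP T I B (fun q => (lpEval B q).comp sub) ψ (fun x y h => ?_)
    (fun q => hχ q), hψ, fun C _ χ' hχ' => exists_starHom_of_norm_starEval_le hψ fun e => ?_⟩
  · exact Subtype.ext (lp.ext (funext h))
  · let q : I := ⟨fun e => ‖starEval χ' e‖, C, _, χ', hχ', fun _ => rfl⟩
    calc ‖starEval χ' e‖ = ‖starEval (χ q) e‖ := hq q e
      _ = ‖((lpEval B q).comp sub) (starEval ψ e)‖ := by rw [starEval_comp]; rfl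
      _ ≤ _ := NonUnitalStarAlgHom.norm_apply_le _ _

end Universal

/-! ### Existence of the Toeplitz algebra. -/

namespace TransferSystem

variable {A : Type u} [NonUnitalCStarAlgebra A] [PartialOrder A] [StarOrderedRing A]
  {S : Type v} [AddCommMonoid S] {D : TransferSystem A S}

lemma IsToeplitzRep.norm_le {B : Type*} [NonUnitalCStarAlgebra B] {ψ : D.ProductSystem → B}
    (h : D.IsToeplitzRep ψ) (x : Σ s : S, D.Fiber s) : ‖ψ x‖ ≤ √‖D.inner x.1 x.2 x.2‖ := by
  obtain ⟨ψ₀, hψ₀⟩ := h.hom_zero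
  refine Real.le_sqrt_of_sq_le ?_
  have h1 : star (ψ x) * ψ x = ψ₀ (D.inner x.1 x.2 x.2) :=
    (h.map_inner x.1 x.2 x.2).trans (hψ₀ _).symm
  rw [sq, ← CStarRing.norm_star_mul_self, h1]
  exact NonUnitalStarAlgHom.norm_apply_le _ _

/-- Every Toeplitz relation is an equation, hence detected by the `φ i`; the homomorphism on `A` is
no extra datum, as it must be the restriction of `ψ` to the zero fibre. -/
lemma isToeplitzRep_of_jointly_injective {T : Type*} [NonUnitalCStarAlgebra T] {ι : Type*}
    {B : ι → Type*} [∀ i, NonUnitalCStarAlgebra (B i)] (φ : ∀ i, T →⋆ₙₐ[ℂ] B i)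
    {ψ : D.ProductSystem → T} (hφ : ∀ x y, (∀ i, φ i x = φ i y) → x = y)
    (h : ∀ i, D.IsToeplitzRep fun x => φ i (ψ x)) : D.IsToeplitzRep ψ where
  map_mul x y := hφ _ _ fun i => ((h i).map_mul x y).trans (map_mul (φ i) _ _).symm
  map_add s x y := hφ _ _ fun i => ((h i).map_add s x y).trans (map_add (φ i) _ _).symm
  map_smul s c x := hφ _ _ fun i => ((h i).map_smul s c x).trans (map_smul (φ i) c _).symm
  hom_zero := by
    choose ρ hρ using fun i => (h i).hom_zero
    exact ⟨{
      toFun a := ψ ⟨0, D.toFiber 0 a⟩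
      map_smul' c a := hφ _ _ fun i => by
        rw [← hρ, MonoidHom.id_apply, map_smul (φ i), map_smul, hρ]
      map_zero' := hφ _ _ fun i => by rw [← hρ, map_zero (φ i), map_zero]
      map_add' a b := hφ _ _ fun i => by rw [← hρ, map_add (φ i), map_add, hρ, hρ]
      map_mul' a b := hφ _ _ fun i => by rw [← hρ, map_mul (φ i), map_mul, hρ, hρ]
      map_star' a := hφ _ _ fun i => by rw [← hρ, map_star (φ i), map_star, hρ] }, fun a => rfl⟩
  map_right s x a := hφ _ _ fun i => ((h i).map_right s x a).trans (map_mul (φ i) _ _).symm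
  map_inner s x y := hφ _ _ fun i => by
    rw [map_mul (φ i), map_star (φ i)]
    exact (h i).map_inner s x y
  map_left s a x := hφ _ _ fun i => ((h i).map_left s a x).trans (map_mul (φ i) _ _).symm

variable (D) in
theorem exists_isToeplitzAlgebra :
    ∃ (T : Type (max u v)) (_ : NonUnitalCStarAlgebra T) (iX : D.ProductSystem → T),
      D.IsToeplitzAlgebra T iX := by
  obtain ⟨T, iT, iX, h1, h2, h3⟩ := exists_universal_cstarAlgebra (X := D.ProductSystem)
    (fun B _ ψ => D.IsToeplitzRep ψ) _ (fun B _ ψ h => h.norm_le)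
    fun T _ ι B _ φ ψ hφ h => isToeplitzRep_of_jointly_injective φ hφ h
  exact ⟨T, iT, iX, h1, h2, h3⟩

end TransferSystem

namespace TransferSystem

variable {A : Type u} [NonUnitalCStarAlgebra A] [PartialOrder A] [StarOrderedRing A]
  {S : Type v} [AddCommMonoid S] {D : TransferSystem A S}

/-! ### Elements of the fibres -/

variable (D) in
lemma αBar_one_snd_snd (s : S) (a : A) :
    (D.αBar s 1).snd ((D.αBar s 1).snd a) = (D.αBar s 1).snd a :=
  D.mem_cornerIdeal.1 ⟨a, rfl⟩

variable (D) in
lemma αBar_zero_one_snd (a : A) : (D.αBar 0 1).snd a = a := by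
  simpa only [D.α_zero] using (D.isMultiplierExtension_αBar 0).snd_one_apply a

variable (D) in
lemma αBar_one_snd_mul_alpha (s : S) (a b : A) :
    (D.αBar s 1).snd a * D.α s b = a * D.α s b := by
  rw [DoubleCentralizer.central, αBar_fst_alpha]
  rfl

lemma incl_toPreFiber (s : S) (a : A) : D.incl s (D.toPreFiber s a) = (D.αBar s 1).snd a := rfl

lemma toPreFiber_incl (s : S) (x : D.PreFiber s) : D.toPreFiber s (D.incl s x) = x :=
  Subtype.ext (D.mem_cornerIdeal.1 (D.incl_mem s x))

lemma toFiber_incl (s : S) (x : D.PreFiber s) : D.toFiber s (D.incl s x) = (x : D.Fiber s) :=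
  congrArg _ (toPreFiber_incl s x)

lemma toFiber_add (s : S) (a b : A) : D.toFiber s (a + b) = D.toFiber s a + D.toFiber s b := by
  rw [toFiber, toFiber, toFiber, ← UniformSpace.Completion.coe_add]
  exact congrArg _ (Subtype.ext (map_add (D.αBar s 1).snd a b))

lemma toFiber_smul (s : S) (c : ℂ) (a : A) : D.toFiber s (c • a) = c • D.toFiber s a := by
  rw [toFiber, toFiber, ← UniformSpace.Completion.coe_smul]
  exact congrArg _ (Subtype.ext (map_smul (D.αBar s 1).snd c a))

lemma toFiber_αBar_one_snd (s : S) (a : A) :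
    D.toFiber s ((D.αBar s 1).snd a) = D.toFiber s a :=
  congrArg (fun x : D.PreFiber s => (x : D.Fiber s)) (Subtype.ext (D.αBar_one_snd_snd s a))

lemma left_toFiber (s : S) (a b : A) : D.left s a (D.toFiber s b) = D.toFiber s (a * b) := by
  rw [toFiber, left_coe]
  exact congrArg _ (Subtype.ext (multiplier_snd_mul _ a b).symm)

lemma right_toFiber (s : S) (a b : A) :
    D.right s b (D.toFiber s a) = D.toFiber s (a * D.α s b) := by
  rw [toFiber, right_coe]
  refine congrArg _ (Subtype.ext ?_)
  change (D.αBar s 1).snd a * D.α s b = (D.αBar s 1).snd (a * D.α s b)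
  rw [αBar_one_snd_mul_alpha, multiplier_snd_mul,
    (D.isMultiplierExtension_αBar s).snd_one_apply]

lemma fiberMul_toFiber (t s : S) (a b : A) (hb : b ∈ D.cornerIdeal s) :
    D.fiberMul t s (D.toFiber t a) (D.toFiber s b) = D.toFiber (t + s) (a * D.α t b) := by
  rw [toFiber, toFiber, fiberMul_coe]
  refine congrArg _ (Subtype.ext ?_)
  change (D.αBar t 1).snd a * D.α t ((D.αBar s 1).snd b) = (D.αBar (t + s) 1).snd (a * D.α t b)
  rw [D.mem_cornerIdeal.1 hb, αBar_one_snd_mul_alpha,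
    D.mem_cornerIdeal.1 (D.mul_alpha_mem_add t s a hb)]

lemma inner_toFiber (s : S) (a b : A) :
    D.inner s (D.toFiber s a) (D.toFiber s b) = D.L s (star a * b) := by
  have h : ∀ y, D.L s ((D.αBar s 1).snd y) = D.L s y := fun y => D.L_αBar_snd s 1 y
  rw [toFiber, toFiber, inner_coe, incl_toPreFiber, incl_toPreFiber, ← multiplier_snd_mul, h,
    ← star_star b, ← star_mul, L_star, star_star, ← multiplier_snd_mul, h, ← L_star, star_mul,
    star_star]

lemma dense_toFiber (s : S) : DenseRange (D.toFiber s) := by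
  refine UniformSpace.Completion.denseRange_coe.mono ?_
  rintro _ ⟨x, rfl⟩
  exact ⟨D.incl s x, toFiber_incl s x⟩

-- Extendibility gives this limit for one approximate unit `(v)` only. For an arbitrary one, `a
-- α_s(u) = y α_s(u)` with `y` the limit. Here `y` is close to some `a α_s(v)`, and `α_s(v u) →
-- α_s(v)`. This is why `i_S` does not depend on the approximate unit.
variable (D) in
lemma tendsto_mul_alpha {l : Filter A} (hl : IsBoundedApproximateUnit l) (s : S) (a : A) :
    Tendsto (fun u => a * D.α s u) l (𝓝 ((D.αBar s 1).snd a)) := by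
  obtain ⟨C, hC⟩ := hl.bounded
  have := hl.isApproximateUnit.neBot
  have hC0 : 0 ≤ C := let ⟨u, hu⟩ := hC.exists; (norm_nonneg _).trans hu
  obtain ⟨k, hk, hks⟩ := (D.isMultiplierExtension_αBar s).strict_one
  have := hk.isApproximateUnit.neBot
  set y := (D.αBar s 1).snd a with hy
  have hlim : Tendsto (fun v => a * D.α s v) k (𝓝 y) := (hks a).2
  rw [Metric.tendsto_nhds]
  intro ε hε
  -- The error from `v` is counted `C + 1` times: once directly and `C` times after multiplication
  -- by `α_s(u)`.
  obtain ⟨v, hv⟩ := (Metric.tendsto_nhds.1 hlim (ε / (2 * (C + 1 + 1))) (by positivity)).exists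
  rw [lt_div_iff₀ (by positivity)] at hv
  have h1 : Tendsto (fun u => a * D.α s (v * u)) l (𝓝 (a * D.α s v)) :=
    (((D.continuous_α s).tendsto v).comp (hl.isApproximateUnit.tendsto_mul_left v)).const_mul a
  filter_upwards [hC, Metric.tendsto_nhds.1 h1 (ε / 2) (by positivity)] with u hu huv
  have h2 : dist (a * D.α s u) (a * D.α s (v * u)) ≤ dist (a * D.α s v) y * C := by
    rw [← D.αBar_one_snd_mul_alpha, ← hy, map_mul, ← mul_assoc, dist_eq_norm, ← sub_mul,
      dist_comm, dist_eq_norm]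
    exact (norm_mul_le _ _).trans (by
      gcongr
      exact (NonUnitalStarAlgHom.norm_apply_le (D.α s) u).trans hu)
  have h3 := dist_triangle4 (a * D.α s u) (a * D.α s (v * u)) (a * D.α s v) y
  nlinarith [dist_nonneg (x := a * D.α s v) (y := y)]

/-! ### Toeplitz representations -/

namespace IsToeplitzRep

variable {B : Type*} [NonUnitalCStarAlgebra B] {ψ : D.ProductSystem → B}

/-- The restriction of a Toeplitz representation to a fibre. -/
def clm (h : D.IsToeplitzRep ψ) (s : S) : D.Fiber s →L[ℂ] B :=
  LinearMap.mkContinuous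
    { toFun x := ψ ⟨s, x⟩
      map_add' := h.map_add s
      map_smul' := h.map_smul s } √‖D.inner s‖ fun x => by
    refine (h.norm_le ⟨s, x⟩).trans ?_
    change √‖D.inner s x x‖ ≤ √‖D.inner s‖ * ‖x‖
    rw [← Real.sqrt_sq (norm_nonneg x), ← Real.sqrt_mul (norm_nonneg (D.inner s))]
    refine Real.sqrt_le_sqrt ?_
    rw [sq, ← mul_assoc]
    exact (D.inner s).le_opNorm₂ x x

/-- The composition of a Toeplitz representation with `toFiber s : A → M_s`. -/
def fiberMap (h : D.IsToeplitzRep ψ) (s : S) : A →L[ℂ] B :=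
  LinearMap.mkContinuous
    { toFun a := ψ ⟨s, D.toFiber s a⟩
      map_add' a b := by rw [toFiber_add, h.map_add]
      map_smul' c a := by rw [toFiber_smul, h.map_smul, RingHom.id_apply] } √‖D.L s‖ fun a => by
    refine (h.norm_le ⟨s, D.toFiber s a⟩).trans ?_
    rw [← Real.sqrt_sq (norm_nonneg a), ← Real.sqrt_mul (norm_nonneg _)]
    refine Real.sqrt_le_sqrt ?_
    change ‖D.inner s (D.toFiber s a) (D.toFiber s a)‖ ≤ _
    rw [inner_toFiber, sq, ← CStarRing.norm_star_mul_self]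
    exact (D.L s).le_opNorm _

lemma fiberMap_apply (h : D.IsToeplitzRep ψ) (s : S) (a : A) :
    h.fiberMap s a = ψ ⟨s, D.toFiber s a⟩ := rfl

/-- The restriction of a Toeplitz representation to `X_0 = A`. -/
def hom (h : D.IsToeplitzRep ψ) : A →⋆ₙₐ[ℂ] B := h.hom_zero.choose

lemma hom_apply (h : D.IsToeplitzRep ψ) (a : A) : h.hom a = ψ ⟨0, D.toFiber 0 a⟩ :=
  h.hom_zero.choose_spec a

lemma hom_mul_fiberMap (h : D.IsToeplitzRep ψ) (s : S) (a b : A) :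
    h.hom a * h.fiberMap s b = h.fiberMap s (a * b) := by
  rw [hom_apply, fiberMap_apply, fiberMap_apply, ← h.map_left, left_toFiber]

lemma fiberMap_mul_hom (h : D.IsToeplitzRep ψ) (s : S) (a b : A) :
    h.fiberMap s a * h.hom b = h.fiberMap s (a * D.α s b) := by
  rw [hom_apply, fiberMap_apply, fiberMap_apply, ← h.map_right, right_toFiber]

lemma star_fiberMap_mul_fiberMap (h : D.IsToeplitzRep ψ) (s : S) (a b : A) :
    star (h.fiberMap s a) * h.fiberMap s b = h.hom (D.L s (star a * b)) := by
  rw [hom_apply, fiberMap_apply, fiberMap_apply, h.map_inner, inner_toFiber]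

lemma fiberMap_mul_fiberMap (h : D.IsToeplitzRep ψ) (t s : S) (a b : A)
    (hb : b ∈ D.cornerIdeal s) :
    h.fiberMap t a * h.fiberMap s b = h.fiberMap (t + s) (a * D.α t b) := by
  rw [fiberMap_apply h (t + s), ← fiberMul_toFiber _ _ _ _ hb]
  exact (h.map_mul _ _).symm

lemma fiberMap_αBar_one_snd (h : D.IsToeplitzRep ψ) (s : S) (a : A) :
    h.fiberMap s ((D.αBar s 1).snd a) = h.fiberMap s a := by
  rw [fiberMap_apply, fiberMap_apply, toFiber_αBar_one_snd]

lemma fiberMap_zero (h : D.IsToeplitzRep ψ) (a : A) : h.fiberMap 0 a = h.hom a :=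
  (h.hom_apply a).symm

lemma mem_of_fiberMap_mem (h : D.IsToeplitzRep ψ) {K : Set B} (hK : IsClosed K)
    (hm : ∀ s a, h.fiberMap s a ∈ K) : Set.range ψ ⊆ K := by
  rintro _ ⟨⟨s, x⟩, rfl⟩
  exact (dense_toFiber s).induction_on (p := fun x => h.clm s x ∈ K) x
    (hK.preimage (h.clm s).continuous) (hm s)

lemma tendsto_fiberMap_mul_hom (h : D.IsToeplitzRep ψ) {l : Filter A}
    (hl : IsBoundedApproximateUnit l) (s : S) (a : A) :
    Tendsto (fun u => h.fiberMap s a * h.hom u) l (𝓝 (h.fiberMap s a)) := by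
  have := ((h.fiberMap s).continuous.tendsto _).comp (D.tendsto_mul_alpha hl s a)
  rw [fiberMap_αBar_one_snd] at this
  exact this.congr fun u => (h.fiberMap_mul_hom s a u).symm

/-- If the range of `ψ` generates `B`, then the restriction of `ψ` to `X_0 = A` is
non-degenerate. -/
lemma isNondegenerateHom_hom (h : D.IsToeplitzRep ψ)
    (hψ : Dense (NonUnitalStarAlgebra.adjoin ℂ (Set.range ψ) : Set B)) :
    IsNondegenerateHom h.hom := by
  set E := Submodule.span ℂ {c : B | ∃ a b, c = h.hom a * b}
  obtain ⟨l, hl⟩ := exists_isBoundedApproximateUnit A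
  have := hl.isApproximateUnit.neBot
  have hE : ∀ a b, h.hom a * b ∈ E := fun a b => Submodule.subset_span ⟨a, b, rfl⟩
  have hclosed : IsClosed (E.topologicalClosure : Set B) := E.isClosed_topologicalClosure
  -- The closure of `E` is a right ideal, so it suffices that it contains the generators and their
  -- adjoints. The adjoints are the delicate case: `ψ_s(a) i_A(u) = ψ_s(a α_s(u)) → ψ_s(a)`, because
  -- the corner projection does not change the class of `a` in the fibre.
  have h1 : Set.range ψ ⊆ E.topologicalClosure := h.mem_of_fiberMap_mem hclosed fun s a =>
    hclosed.mem_of_tendsto (((h.fiberMap s).continuous.tendsto _).comp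
      (hl.isApproximateUnit.tendsto_mul_right a)) (Eventually.of_forall fun u => by
        refine E.le_topologicalClosure ?_
        rw [Function.comp_apply, ← hom_mul_fiberMap]
        exact hE _ _)
  have h2 : star (Set.range ψ) ⊆ E.topologicalClosure := by
    have : Set.range ψ ⊆ star ⁻¹' (E.topologicalClosure : Set B) :=
      h.mem_of_fiberMap_mem (hclosed.preimage continuous_star) fun s a =>
        hclosed.mem_of_tendsto ((h.tendsto_fiberMap_mul_hom hl s a).star)
          (Eventually.of_forall fun u => by
            refine E.le_topologicalClosure ?_
            rw [star_mul, ← map_star]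
            exact hE _ _)
    intro x hx
    simpa using this hx
  have hmul : ∀ x ∈ E.topologicalClosure, ∀ y, x * y ∈ E.topologicalClosure := fun x hx y => by
    refine map_mem_closure (s := E) (f := fun x => x * y) (by fun_prop) hx fun z hz => ?_
    change z ∈ E at hz
    change z * y ∈ E
    induction hz using Submodule.span_induction with
    | mem z hz =>
      obtain ⟨a, b, rfl⟩ := hz
      rw [mul_assoc]
      exact hE _ _
    | zero => simp
    | add z w _ _ hz hw => rw [add_mul]; exact add_mem hz hw
    | smul c z _ hz => rw [smul_mul_assoc]; exact E.smul_mem _ hz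
  have h3 : ∀ x ∈ NonUnitalAlgebra.adjoin ℂ (Set.range ψ ∪ star (Set.range ψ)),
      x ∈ E.topologicalClosure := fun x hx => by
    induction hx using NonUnitalAlgebra.adjoin_induction with
    | mem x hx => exact hx.elim (fun hx => h1 hx) (fun hx => h2 hx)
    | add x y _ _ hx hy => exact add_mem hx hy
    | zero => exact zero_mem _
    | mul x y _ _ hx _ => exact hmul x hx y
    | smul c x _ hx => exact Submodule.smul_mem _ c hx
  exact dense_iff_closure_eq.2 (Set.eq_univ_of_univ_subset
    (hψ.closure_eq ▸ hclosed.closure_subset_iff.2 fun x hx => h3 x hx))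

end IsToeplitzRep

end TransferSystem

namespace TransferSystem

variable {A : Type u} [NonUnitalCStarAlgebra A] [PartialOrder A] [StarOrderedRing A]
  {S : Type v} [AddCommMonoid S] {D : TransferSystem A S}

/-! ### Toeplitz representations from covariant pairs -/

/-- A covariant pair `(π, V)` gives the Toeplitz representation `x ↦ π(x) V_s`, `x ∈ A_s`. -/
lemma exists_isToeplitzRep_of_covariant {H : Type*} [NormedAddCommGroup H]
    [InnerProductSpace ℂ H] [CompleteSpace H] (π : A →⋆ₙₐ[ℂ] (H →L[ℂ] H)) (V : S → H →L[ℂ] H)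
    (h0 : V 0 = 1) (hadd : ∀ s t, V (s + t) = V s * V t)
    (h1 : ∀ s a, V s * π a = π (D.α s a) * V s)
    (h2 : ∀ s a, star (V s) * π a * V s = π (D.L s a)) :
    ∃ ψ : D.ProductSystem → H →L[ℂ] H, D.IsToeplitzRep ψ ∧
      ∀ s a, ψ ⟨s, D.toFiber s a⟩ = π ((D.αBar s 1).snd a) * V s := by
  let p : ∀ s, D.PreFiber s →ₗ[ℂ] (H →L[ℂ] H) := fun s =>
    { toFun x := π (D.incl s x) * V s
      map_add' x y := by rw [map_add, map_add π, add_mul]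
      map_smul' c x := by rw [map_smul, map_smul π, smul_mul_assoc, RingHom.id_apply] }
  have hp : ∀ s x, p s x = π (D.incl s x) * V s := fun _ _ => rfl
  -- The relation `V_s^* π(·) V_s = π(L_s ·)` makes `p s` contractive for the seminorm of `A_s`, so
  -- it extends to the completion `M_s`.
  have hinner : ∀ s x y, star (p s x) * p s y = π (D.L s (star (D.incl s x) * D.incl s y)) :=
    fun s x y => by
      rw [hp, hp, star_mul, ← map_star π, ← h2, map_mul π]
      simp only [mul_assoc]
  let f : ∀ s, D.Fiber s →L[ℂ] (H →L[ℂ] H) := fun s =>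
    extendCLM ((p s).mkContinuous 1 fun x => by
      rw [one_mul]
      refine le_of_sq_le_sq ?_ (Real.sqrt_nonneg _)
      change _ ≤ ‖x‖ ^ 2
      rw [preFiber_norm_sq, sq, ← CStarRing.norm_star_mul_self, hinner]
      exact NonUnitalStarAlgHom.norm_apply_le π _)
  have hf : ∀ s (x : D.PreFiber s), f s (x : D.Fiber s) = π (D.incl s x) * V s :=
    fun s x => extendCLM_coe _ x
  have hf0 : ∀ a, f 0 (D.toFiber 0 a) = π a := fun a => by
    rw [toFiber, hf, incl_toPreFiber, αBar_zero_one_snd, h0, mul_one]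
  refine ⟨fun x => f x.1 x.2, ⟨?_, fun s => map_add (f s), fun s => map_smul (f s),
    ⟨π, fun a => (hf0 a).symm⟩, ?_, ?_, ?_⟩, fun s a => hf s _⟩
  · rintro ⟨s, x⟩ ⟨t, y⟩
    change f (s + t) (D.fiberMul s t x y) = f s x * f t y
    induction x, y using UniformSpace.Completion.induction_on₂ with
    | hp => exact isClosed_eq (by fun_prop) (by fun_prop)
    | ih x y =>
      rw [fiberMul_coe, hf, hf, hf, incl_preMul, map_mul π, hadd, mul_assoc, mul_assoc,
        ← mul_assoc (V s), h1, mul_assoc]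
  · intro s x a
    change f s (D.right s a x) = f s x * f 0 (D.toFiber 0 a)
    rw [hf0]
    induction x using UniformSpace.Completion.induction_on with
    | hp => exact isClosed_eq (by fun_prop) (by fun_prop)
    | ih x =>
      rw [right_coe, hf, hf, mul_assoc, h1, ← mul_assoc, ← map_mul π]
      rfl
  · intro s x y
    change star (f s x) * f s y = f 0 (D.toFiber 0 (D.inner s x y))
    rw [hf0]
    have hπ : Continuous π := AddMonoidHomClass.continuous_of_bound π 1 fun x => by
      simpa using NonUnitalStarAlgHom.norm_apply_le π x
    induction x, y using UniformSpace.Completion.induction_on₂ with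
    | hp => exact isClosed_eq (by fun_prop) (by fun_prop)
    | ih x y =>
      rw [inner_coe, hf, hf]
      exact hinner s x y
  · intro s a x
    change f s (D.left s a x) = f 0 (D.toFiber 0 a) * f s x
    rw [hf0]
    induction x using UniformSpace.Completion.induction_on with
    | hp => exact isClosed_eq (by fun_prop) (by fun_prop)
    | ih x =>
      rw [left_coe, hf, hf, ← mul_assoc, ← map_mul π]
      rfl

/-! ### The Toeplitz algebra as a crossed product -/

namespace IsToeplitzRep

variable {T : Type*} [NonUnitalCStarAlgebra T] {ψ : D.ProductSystem → T}

lemma eventually_norm_fiberMap_alpha_le (h : D.IsToeplitzRep ψ) {l : Filter A}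
    (hl : IsBoundedApproximateUnit l) (s : S) :
    ∃ C, ∀ᶠ a in l, ‖h.fiberMap s (D.α s a)‖ ≤ C := by
  obtain ⟨C, hC⟩ := hl.bounded
  refine ⟨‖h.fiberMap s‖ * C, hC.mono fun a ha => ((h.fiberMap s).le_opNorm _).trans ?_⟩
  gcongr
  exact (NonUnitalStarAlgHom.norm_apply_le (D.α s) a).trans ha

lemma tendsto_fiberMap_alpha_mul (h : D.IsToeplitzRep ψ) {l : Filter A}
    (hl : IsBoundedApproximateUnit l) (s : S) (a : A) :
    Tendsto (fun u => h.fiberMap s (D.α s u) * h.hom a) l (𝓝 (h.fiberMap s (D.α s a))) := by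
  refine ((((h.fiberMap s).continuous.comp (D.continuous_α s)).tendsto a).comp
    (hl.isApproximateUnit.tendsto_mul_right a)).congr fun u => ?_
  simp only [Function.comp_apply, fiberMap_mul_hom, _root_.map_mul]

lemma tendsto_mul_fiberMap_alpha (h : D.IsToeplitzRep ψ) {l : Filter A}
    (hl : IsBoundedApproximateUnit l) (s : S) (a : A) :
    Tendsto (fun u => h.hom a * h.fiberMap s (D.α s u)) l (𝓝 (h.fiberMap s a)) := by
  have := ((h.fiberMap s).continuous.tendsto _).comp (D.tendsto_mul_alpha hl s a)
  rw [fiberMap_αBar_one_snd] at this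
  exact this.congr fun u => (h.hom_mul_fiberMap s a _).symm

/-- The multiplier `i_S(s) = lim ψ(s, α_s(u))`. -/
lemma exists_multiplier (h : D.IsToeplitzRep ψ) (hφ : IsNondegenerateHom h.hom) (s : S) :
    ∃ m : 𝓜(ℂ, T), (∀ a, m.fst (h.hom a) = h.fiberMap s (D.α s a)) ∧
      (∀ a, m.snd (h.hom a) = h.fiberMap s a) ∧
      ∀ l : Filter A, IsBoundedApproximateUnit l →
        StrictTendsto (fun a => (h.fiberMap s (D.α s a) : 𝓜(ℂ, T))) l m := by
  obtain ⟨k, hk⟩ := exists_isBoundedApproximateUnit A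
  have := hk.isApproximateUnit.neBot
  obtain ⟨C, hC⟩ := h.eventually_norm_fiberMap_alpha_le hk s
  obtain ⟨m, hm⟩ := hφ.exists_strictTendsto hC
    (fun a => ⟨_, h.tendsto_fiberMap_alpha_mul hk s a⟩)
    (fun a => ⟨_, h.tendsto_mul_fiberMap_alpha hk s a⟩)
  have h1 : ∀ a, m.fst (h.hom a) = h.fiberMap s (D.α s a) := fun a =>
    tendsto_nhds_unique (hm _).1 (h.tendsto_fiberMap_alpha_mul hk s a)
  have h2 : ∀ a, m.snd (h.hom a) = h.fiberMap s a := fun a =>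
    tendsto_nhds_unique (hm _).2 (h.tendsto_mul_fiberMap_alpha hk s a)
  refine ⟨m, h1, h2, fun l hl => ?_⟩
  have := hl.isApproximateUnit.neBot
  obtain ⟨C, hC⟩ := h.eventually_norm_fiberMap_alpha_le hl s
  exact hφ.strictTendsto hC (fun a => (h1 a).symm ▸ h.tendsto_fiberMap_alpha_mul hl s a)
    (fun a => (h2 a).symm ▸ h.tendsto_mul_fiberMap_alpha hl s a)

end IsToeplitzRep

/-- A covariant pair not killing `a` yields a Toeplitz representation not killing `a`, and this
factors through `T`. Toeplitz representations need not be non-degenerate, so neither must the pair.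
-/
lemma IsToeplitzAlgebra.injective_hom {T : Type (max u v)} [NonUnitalCStarAlgebra T]
    {iX : D.ProductSystem → T} (hT : D.IsToeplitzAlgebra T iX) :
    Function.Injective hT.isToeplitzRep.hom := by
  refine (injective_iff_map_eq_zero _).2 fun a ha => ?_
  by_contra hne
  obtain ⟨H, _, _, _, π, V, h0, hadd, h1, h2, hπ⟩ := D.exists_covariant_ne_zero hne
  obtain ⟨ψ, hψ, hψV⟩ := exists_isToeplitzRep_of_covariant π V h0 hadd h1 h2
  obtain ⟨σ, hσ⟩ := hT.universal _ ψ hψ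
  apply hπ
  have h3 := (hσ _).trans (hψV 0 a)
  rwa [← hT.isToeplitzRep.hom_apply, ha, map_zero, αBar_zero_one_snd, h0, mul_one,
    eq_comm] at h3

theorem IsToeplitzAlgebra.isToeplitzCrossedProduct {T : Type (max u v)} [NonUnitalCStarAlgebra T]
    {iX : D.ProductSystem → T} (hT : D.IsToeplitzAlgebra T iX) {iS : S → 𝓜(ℂ, T)}
    (hfst : ∀ s a, (iS s).fst (hT.isToeplitzRep.hom a) =
      hT.isToeplitzRep.fiberMap s (D.α s a))
    (hsnd : ∀ s a, (iS s).snd (hT.isToeplitzRep.hom a) = hT.isToeplitzRep.fiberMap s a)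
    (hlim : ∀ s, ∀ l : Filter A, IsBoundedApproximateUnit l →
      StrictTendsto (fun a => (hT.isToeplitzRep.fiberMap s (D.α s a) : 𝓜(ℂ, T))) l (iS s)) :
    D.IsToeplitzCrossedProduct T hT.isToeplitzRep.hom iS := by
  set h := hT.isToeplitzRep
  have hφ : IsNondegenerateHom h.hom := h.isNondegenerateHom_hom hT.generated
  -- Along an approximate unit, `ψ_s(α_s(u)) ψ_t(α_t(a)) = ψ_{s+t}(α_s(u α_t(a)))`. This yields the
  -- semigroup law for `i_S`.
  have hmul : ∀ s t a, (iS s).fst (h.fiberMap t (D.α t a)) =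
      h.fiberMap (s + t) (D.α (s + t) a) := fun s t a => by
    obtain ⟨l, hl⟩ := exists_isBoundedApproximateUnit A
    have := hl.isApproximateUnit.neBot
    refine tendsto_nhds_unique (hlim s l hl _).1 ?_
    rw [D.α_add]
    refine ((((h.fiberMap (s + t)).continuous.comp (D.continuous_α s)).tendsto _).comp
      (hl.isApproximateUnit.tendsto_mul_right (D.α t a))).congr fun u => ?_
    simp only [Function.comp_apply, DoubleCentralizer.coe_fst, ContinuousLinearMap.mul_apply']
    rw [h.fiberMap_mul_fiberMap s t _ _ (D.alpha_mem t a), map_mul]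
  have htc1 : ∀ s a, iS s * (h.hom a : 𝓜(ℂ, T)) = (h.hom (D.α s a) : 𝓜(ℂ, T)) * iS s :=
    fun s a => by rw [multiplier_mul_coe, multiplier_coe_mul_left, hfst, hsnd]
  have htc2 : ∀ s a, star (iS s) * (h.hom a : 𝓜(ℂ, T)) * iS s =
      (h.hom (D.L s a) : 𝓜(ℂ, T)) := fun s a => by
    rw [mul_assoc, multiplier_coe_mul_left, hsnd, multiplier_mul_coe]
    congr 1
    -- Only products with `b i_A(y)` need testing, and `i_A(y) i_S(s)^* = ψ_s(α_s(y^*))^*` reduces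
    -- the claim to the inner product relation and `L_s(α_s(y) a) = y L_s(a)`.
    refine eq_of_forall_mul_left_eq (DFunLike.congr_fun (ContinuousLinearMap.ext_on
      (f := (ContinuousLinearMap.mul ℂ T).flip ((star (iS s)).fst (h.fiberMap s a)))
      (g := (ContinuousLinearMap.mul ℂ T).flip (h.hom (D.L s a))) hφ.dense_right ?_))
    rintro _ ⟨b, y, rfl⟩
    simp only [ContinuousLinearMap.flip_apply, ContinuousLinearMap.mul_apply']
    rw [mul_assoc, mul_assoc, ← DoubleCentralizer.central, DoubleCentralizer.star_snd,
      ← map_star h.hom, hfst, h.star_fiberMap_mul_fiberMap, ← map_star (D.α s), star_star,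
      L_alpha_mul, map_mul h.hom]
  have hrep : ∀ {H : Type (max u v)} [NormedAddCommGroup H] [InnerProductSpace ℂ H]
      [CompleteSpace H] (σ : T →⋆ₙₐ[ℂ] (H →L[ℂ] H)), IsNondegenerateRep σ →
      IsNondegenerateRep (σ.comp h.hom) := fun {H} _ _ _ σ hσ => by
    have hσc : Continuous σ := AddMonoidHomClass.continuous_of_bound σ 1 fun x => by
      simpa using NonUnitalStarAlgHom.norm_apply_le σ x
    set W := Submodule.span ℂ {x : H | ∃ a k, x = (σ.comp h.hom) a k}
    have hW : ∀ b k, σ b k ∈ W.topologicalClosure := fun b k => by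
      refine hφ.induction (P := fun b => σ b k ∈ W.topologicalClosure) (fun b hb => ?_)
        (W.isClosed_topologicalClosure.preimage (hσc.clm_apply continuous_const)) b
      induction hb using Submodule.span_induction with
      | mem b hb =>
        obtain ⟨a, c, rfl⟩ := hb
        exact W.le_topologicalClosure (Submodule.subset_span ⟨a, σ c k, by
          rw [map_mul σ]; rfl⟩)
      | zero => simp
      | add x y _ _ hx hy => rw [map_add σ]; exact add_mem hx hy
      | smul c x _ hx => rw [map_smul σ]; exact Submodule.smul_mem _ c hx
    have hle : Submodule.span ℂ {x : H | ∃ b k, x = σ b k} ≤ W.topologicalClosure :=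
      Submodule.span_le.2 (by rintro _ ⟨b, k, rfl⟩; exact hW b k)
    exact dense_iff_closure_eq.2 (Set.eq_univ_of_univ_subset
      (hσ.closure_eq ▸ W.isClosed_topologicalClosure.closure_subset_iff.2 hle))
  have hzero : iS 0 = 1 := hφ.multiplier_ext fun a => by
    rw [hfst, D.α_zero, h.fiberMap_zero]
    rfl
  have hadd : ∀ s t, iS (s + t) = iS s * iS t := fun s t => hφ.multiplier_ext fun a => by
    rw [hfst, DoubleCentralizer.mul_fst, ContinuousLinearMap.mul_def,
      ContinuousLinearMap.comp_apply, hfst, hmul]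
  refine ⟨hφ, hzero, hadd, fun H _ _ _ σ hσ => ?_, fun H _ _ _ π V hV => ?_, ?_⟩
  · obtain ⟨σ', hσ'⟩ := hσ.exists_extension
    refine ⟨σ', hσ', hrep σ hσ, ?_, fun s t => ?_, fun s a => ?_, fun s a => ?_⟩
    · change σ' (iS 0) = 1
      rw [hzero, map_one]
    · change σ' (iS (s + t)) = σ' (iS s) * σ' (iS t)
      rw [hadd, map_mul]
    · change σ' (iS s) * σ (h.hom a) = σ (h.hom (D.α s a)) * σ' (iS s)
      rw [← hσ', ← hσ', ← map_mul, ← map_mul, htc1]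
    · change star (σ' (iS s)) * σ (h.hom a) * σ' (iS s) = σ (h.hom (D.L s a))
      rw [← hσ', ← hσ', ← map_star, ← map_mul, ← map_mul, htc2]
  · obtain ⟨ψ, hψ, hψV⟩ := exists_isToeplitzRep_of_covariant π V hV.map_zero hV.map_add
      hV.tc1 hV.tc2
    obtain ⟨σ, hσ⟩ := hT.universal _ ψ hψ
    have hσf : ∀ s a, σ (h.fiberMap s a) = π ((D.αBar s 1).snd a) * V s := fun s a =>
      (hσ _).trans (hψV s a)
    have hσπ : ∀ a, σ (h.hom a) = π a := fun a => by
      rw [← h.fiberMap_zero, hσf, αBar_zero_one_snd, hV.map_zero, mul_one]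
    have hσn : IsNondegenerateRep σ := hV.nondegenerate.mono (Submodule.span_mono (by
      rintro _ ⟨a, k, rfl⟩
      exact ⟨h.hom a, k, by rw [hσπ]⟩))
    obtain ⟨σ', hσ'⟩ := hσn.exists_extension
    refine ⟨σ, hσn, hσπ, σ', hσ', fun s => ContinuousLinearMap.ext_on hV.nondegenerate ?_⟩
    rintro _ ⟨a, k, rfl⟩
    -- Both sides equal `π(α_s(a)) V_s`; non-degeneracy of `π` then identifies the operators.
    have h1 : σ' (iS s) * π a = V s * π a := by
      rw [hV.tc1, ← hσπ a, ← hσ', ← map_mul, multiplier_mul_coe, hσ', hfst, hσf,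
        (D.isMultiplierExtension_αBar s).snd_one_apply]
    exact congrArg (fun R : H →L[ℂ] H => R k) h1
  · set G := NonUnitalStarAlgebra.adjoin ℂ {b : T | ∃ a s, b = (iS s).snd (h.hom a)}
    have hG : Set.range iX ⊆ G.topologicalClosure :=
      h.mem_of_fiberMap_mem (NonUnitalStarSubalgebra.isClosed_topologicalClosure G) fun s a =>
        G.le_topologicalClosure (NonUnitalStarAlgebra.subset_adjoin ℂ _ ⟨a, s, (hsnd s a).symm⟩)
    have hle : NonUnitalStarAlgebra.adjoin ℂ (Set.range iX) ≤ G.topologicalClosure :=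
      NonUnitalStarAlgebra.adjoin_le hG
    exact dense_iff_closure_eq.2 (Set.eq_univ_of_univ_subset (hT.generated.closure_eq ▸
      (NonUnitalStarSubalgebra.isClosed_topologicalClosure G).closure_subset_iff.2 hle))

end TransferSystem

end

theorem mainTheorem5 {A : Type u} [NonUnitalCStarAlgebra A] [PartialOrder A] [StarOrderedRing A]
    {S : Type v} [AddCommMonoid S] (D : TransferSystem A S) :
    (∃ (T : Type (max u v)) (_ : NonUnitalCStarAlgebra T) (iX : D.ProductSystem → T),
      D.IsToeplitzAlgebra T iX) ∧
    ∀ (T : Type (max u v)) [NonUnitalCStarAlgebra T] (iX : D.ProductSystem → T),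
      D.IsToeplitzAlgebra T iX →
      (∀ l : Filter A, IsBoundedApproximateUnit l → ∀ s : S, ∃ m : 𝓜(ℂ, T),
        StrictTendsto (fun a : A => (iX ⟨s, D.toFiber s (D.α s a)⟩ : 𝓜(ℂ, T))) l m) ∧
      ∃ (iA : A →⋆ₙₐ[ℂ] T) (iS : S → 𝓜(ℂ, T)),
        (∀ a, iA a = iX ⟨0, D.toFiber 0 a⟩) ∧
        (∀ l : Filter A, IsBoundedApproximateUnit l → ∀ s : S,
          StrictTendsto (fun a : A => (iX ⟨s, D.toFiber s (D.α s a)⟩ : 𝓜(ℂ, T))) l (iS s)) ∧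
        D.IsToeplitzCrossedProduct T iA iS ∧
        Function.Injective iA := by
  refine ⟨D.exists_isToeplitzAlgebra, fun T _ iX hT => ?_⟩
  have h := hT.isToeplitzRep
  choose iS hfst hsnd hlim using
    h.exists_multiplier (h.isNondegenerateHom_hom hT.generated)
  exact ⟨fun l hl s => ⟨iS s, hlim s l hl⟩, h.hom, iS, h.hom_apply, fun l hl s => hlim s l hl,
    hT.isToeplitzCrossedProduct hfst hsnd hlim, hT.injective_hom⟩
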